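/- Let $\mathbb{T}=\mathbb{R}/\mathbb{Z}$ carry the wrap-around distance $|x-y|_1=\min_{k\in\mathbb{Z}}|x-y+k|$ and Lebesgue measure $\lambda$ ($\lambda(\mathbb{T})=1$). For complex Borel measures $\nu,\mu$ on $\mathbb{T}$ let $$W_1(\nu,\mu)=\sup_{f}\Big|\int_{\mathbb{T}} f\,\mathrm{d}(\nu-\mu)\Big|\in[0,\infty],$$ the supremum being over all $f:\mathbb{T}\to\mathbb{C}$ with $|f(x)-f(y)|\le|x-y|_1$ for all $x,y$. For a trigonometric polynomial $p(x)=\sum_{|k|\le n}c_k e^{2\pi i kx}$ ($c_k\in\mathbb{C}$; degree at most $n$) write $W_1(p,\mu)=W_1(p\,\mathrm{d}x,\mu)$. Let $\mathcal{B}_1$ be the 1-periodic Bernoulli spline of degree one, $\mathcal{B}_1(x)=\sum_{k\ge1}\frac{\sin(2\pi kx)}{\pi k}$, i.e. $\mathcal{B}_1(x)=\frac12-x$ for $0<x<1$ and $\mathcal{B}_1(0)=0$, and let $(\mathcal{B}_1*\mu)(t)=\int_{\mathbb{T}}\mathcal{B}_1(t-x)\,\mathrm{d}\mu(x)$. 1.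 Let $\nu,\mu$ be real (signed, finite) Borel measures on $\mathbb{T}$ with $\nu(\mathbb{T})=\mu(\mathbb{T})=1$. Then $\mathcal{B}_1*\nu-\mathcal{B}_1*\mu\in L^1(\mathbb{T})$ and $W_1(\nu,\mu)$ is the $L^1$-distance of $\mathcal{B}_1*\nu$ and $\mathcal{B}_1*\mu$ modulo constants: $$W_1(\nu,\mu)=\min_{c\in\mathbb{R}}\int_{\mathbb{T}}\big|(\mathcal{B}_1*\nu)(t)-(\mathcal{B}_1*\mu)(t)-c\big|\,\mathrm{d}t .$$ Moreover, $W_1(\nu,\mu)=\|\mathcal{B}_1*\nu-\mathcal{B}_1*\mu\|_{L^1(\mathbb{T})}$ holds if and only if $0$ is a median of $\mathcal{B}_1*\nu-\mathcal{B}_1*\mu$, that is, $\lambda\{\mathcal{B}_1*\nu-\mathcal{B}_1*\mu>0\}\le\frac12$ and $\lambda\{\mathcal{B}_1*\nu-\mathcal{B}_1*\mu<0\}\le\frac12$. 2. Let $n\in\mathbb{N}_0$ and let $\mu$ be a real (signed, finite) Borel measure on $\mathbb{T}$ with $\mu(\mathbb{T})=1$ that is absolutely continuous with respect to $\lambda$.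 Then there is exactly one trigonometric polynomial $p$ of degree at most $n$, with complex coefficients, such that $W_1(p,\mu)\le W_1(q,\mu)$ for every trigonometric polynomial $q$ of degree at most $n$; and this $p$ is real-valued. -/

import Mathlib

open MeasureTheory

open scoped ENNReal

noncomputable section

namespace TorusApprox

/-- The torus `𝕋 = ℝ / ℤ`, with its quotient (wrap-around) metric, its Borel σ-algebra and Lebesgue
measure `volume` of total mass `1`. -/
abbrev Torus : Type := UnitAddCircle

/-- The integral `∫ f dκ` of a complex-valued function against a complex measure. -/
def cintegral (κ : ComplexMeasure Torus) (f : Torus → ℂ) : ℂ :=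
  VectorMeasure.integral κ f (ContinuousLinearMap.mul ℝ ℂ)

/-- The Wasserstein-1 distance of two complex measures in its dual form: the supremum of
`|∫ f d(ν - μ)|` over all `f : 𝕋 → ℂ` with Lipschitz constant at most `1`. -/
def W1 (ν μ : ComplexMeasure Torus) : ℝ≥0∞ :=
  ⨆ (f : Torus → ℂ) (_ : LipschitzWith 1 f), ‖cintegral (ν - μ) f‖ₑ

/-- A real (signed) measure, seen as a complex measure. -/
def ofReal (μ : SignedMeasure Torus) : ComplexMeasure Torus :=
  SignedMeasure.toComplexMeasure μ 0

/-- The complex measure `p dx` with density `p`. -/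
def ofDensity (p : C(Torus, ℂ)) : ComplexMeasure Torus :=
  Measure.withDensityᵥ volume (fun x => p x)

/-- The 1-periodic Bernoulli spline of degree one, `𝓑₁(x) = ∑_{k ≥ 1} sin(2πkx) / (πk)`; that is,
`𝓑₁(x) = 1/2 - x` for `0 < x < 1`, and `𝓑₁(0) = 0`. -/
def bernoulliSpline (x : Torus) : ℝ :=
  if x = 0 then 0 else 1 / 2 - (AddCircle.equivIco 1 0 x : ℝ)

/-- The convolution `(𝓑₁ * μ)(t) = ∫ 𝓑₁(t - x) dμ(x)`. -/
def bernoulliConv (μ : SignedMeasure Torus) (t : Torus) : ℝ :=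
  VectorMeasure.integral μ (fun x => bernoulliSpline (t - x)) (ContinuousLinearMap.mul ℝ ℝ)

/-- The trigonometric polynomials `∑_{|k| ≤ n} c_k e^{2πikx}` of degree at most `n`. -/
def trigPoly (n : ℕ) : Submodule ℂ C(Torus, ℂ) :=
  Submodule.span ℂ ((fun k : ℤ => fourier k) '' Set.Icc (-(n : ℤ)) n)

/-- `p` is a best `W₁`-approximation of `μ` by trigonometric polynomials of degree at most `n`. -/
def IsBestApprox (n : ℕ) (μ : ComplexMeasure Torus) (p : C(Torus, ℂ)) : Prop :=
  p ∈ trigPoly n ∧ ∀ q ∈ trigPoly n, W1 (ofDensity p) μ ≤ W1 (ofDensity q) μ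

end TorusApprox

end

/-! Duality. The derivative `g` of a real 1-Lipschitz function `f` has mean zero and `|g| ≤ 1`, and
`f` is a constant plus the convolution of the spline with `g`; conversely every such `g` yields a
1-Lipschitz function (`exists_density_of_lipschitz`, `lipschitzWith_splineConv`). For a signed
measure `σ` of mass zero, Fubini and oddness of the spline turn `∫ f dσ` into `-∫ g F` with `F` the
spline convolution of `σ`. Since `g` has mean zero, `F` may be replaced by `F - c`, which bounds the
supremum by `‖F - c‖₁` for every `c`. At a median `m` the sign of `F - m`, corrected on `{F = m}` to
have mean zero, attains `‖F - m‖₁`. Complex test functions add nothing for real measures, by a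
rotation.

Best approximation. Existence is compactness: `W1` is lower semicontinuous on a finite-dimensional
space and controls every Fourier coefficient. A minimiser is real, because a nonzero imaginary part
would make its real part strictly closer to `μ` (`im_eq_zero_of_isBestApprox`). For uniqueness, the
nonzero-frequency coefficients of the spline do not vanish, so convolution with it is a bijection of
trigonometric polynomials modulo constants. The problem becomes best `L¹` approximation of the
function `bernoulliConv μ`, continuous since `μ` has no atoms, and Jackson's theorem
(`best_mean_approx_unique`) applies: the difference of two best approximations has at most `2n`
zeros, and a trigonometric polynomial with the sign pattern of the error would improve their
midpoint. -/

noncomputable section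

namespace TorusApprox

/-! ### Integration against signed and complex measures -/

/-- The integral of a real function against a signed measure. -/
def sintegral (σ : SignedMeasure Torus) (g : Torus → ℝ) : ℝ :=
  VectorMeasure.integral σ g (ContinuousLinearMap.mul ℝ ℝ)

instance isFiniteMeasure_variation_signed (σ : SignedMeasure Torus) :
    IsFiniteMeasure σ.variation := by
  rw [← SignedMeasure.totalVariation_eq_variation, SignedMeasure.totalVariation]
  infer_instance

lemma variation_re_le (κ : ComplexMeasure Torus) :
    (ComplexMeasure.re κ).variation ≤ κ.variation := by
  refine VectorMeasure.variation_le_of_forall_enorm_le fun s _ => ?_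
  refine le_trans ?_ (VectorMeasure.enorm_measure_le_variation κ s)
  rw [enorm_le_iff_norm_le]
  exact Complex.abs_re_le_norm (κ s)

lemma variation_im_le (κ : ComplexMeasure Torus) :
    (ComplexMeasure.im κ).variation ≤ κ.variation := by
  refine VectorMeasure.variation_le_of_forall_enorm_le fun s _ => ?_
  refine le_trans ?_ (VectorMeasure.enorm_measure_le_variation κ s)
  rw [enorm_le_iff_norm_le]
  exact Complex.abs_im_le_norm (κ s)

/-- The real and imaginary parts have finite variation by Jordan decomposition, and their sum
dominates. Finiteness makes bounded measurable functions integrable. -/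
instance isFiniteMeasure_variation_complex (κ : ComplexMeasure Torus) :
    IsFiniteMeasure κ.variation := by
  have h : κ.variation ≤ (ComplexMeasure.re κ).variation + (ComplexMeasure.im κ).variation := by
    refine VectorMeasure.variation_le_of_forall_enorm_le fun s _ => ?_
    have h1 : ‖κ s‖ₑ ≤ ‖(ComplexMeasure.re κ) s‖ₑ + ‖(ComplexMeasure.im κ) s‖ₑ := by
      have : κ s = ((ComplexMeasure.re κ s : ℝ) : ℂ) + ((ComplexMeasure.im κ s : ℝ) : ℂ) * Complex.I :=
        (Complex.re_add_im (κ s)).symm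
      rw [this]
      refine (enorm_add_le _ _).trans ?_
      gcongr
      · rw [enorm_le_iff_norm_le]; simp
      · rw [enorm_le_iff_norm_le]; simp
    refine h1.trans ?_
    rw [Measure.add_apply]
    gcongr <;> exact VectorMeasure.enorm_measure_le_variation _ s
  exact isFiniteMeasure_of_le _ h

lemma sintegral_add (σ : SignedMeasure Torus) {f g : Torus → ℝ}
    (hf : Integrable f σ.variation) (hg : Integrable g σ.variation) :
    sintegral σ (fun x => f x + g x) = sintegral σ f + sintegral σ g :=
  VectorMeasure.integral_fun_add hf hg

lemma sintegral_const (σ : SignedMeasure Torus) (c : ℝ) :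
    sintegral σ (fun _ => c) = c * σ Set.univ := by
  simp [sintegral, VectorMeasure.integral_const]

lemma sintegral_const_mul (σ : SignedMeasure Torus) (c : ℝ) (f : Torus → ℝ) :
    sintegral σ (fun x => c * f x) = c * sintegral σ f :=
  VectorMeasure.integral_fun_smul σ (ContinuousLinearMap.mul ℝ ℝ) c f

lemma sintegral_sub_measure (ν μ : SignedMeasure Torus) {f : Torus → ℝ}
    (hν : Integrable f ν.variation) (hμ : Integrable f μ.variation) :
    sintegral (ν - μ) f = sintegral ν f - sintegral μ f :=
  VectorMeasure.integral_sub_vectorMeasure hν hμ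

lemma sintegral_toSignedMeasure (m : Measure Torus) [IsFiniteMeasure m] (f : Torus → ℝ) :
    sintegral m.toSignedMeasure f = ∫ x, f x ∂m := by
  have h : ContinuousLinearMap.mul ℝ ℝ = (ContinuousLinearMap.lsmul ℝ ℝ (E := ℝ)).flip := by
    ext; simp
  rw [sintegral, h, VectorMeasure.integral_toSignedMeasure]

/-- A bounded measurable function is integrable against every finite measure. -/
lemma integrable_of_abs_le {m : Measure Torus} [IsFiniteMeasure m] {E : Type*}
    [NormedAddCommGroup E] {f : Torus → E} (hf : AEStronglyMeasurable f m) (C : ℝ)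
    (h : ∀ x, ‖f x‖ ≤ C) : Integrable f m :=
  Integrable.of_bound hf C (Filter.Eventually.of_forall h)

/-- Gives access to Fubini and measurability of parameter integrals, which are applied to positive
measures. -/
lemma sintegral_eq_jordan (σ : SignedMeasure Torus) {f : Torus → ℝ} (hf : Measurable f) (C : ℝ)
    (h : ∀ x, ‖f x‖ ≤ C) :
    sintegral σ f = ∫ x, f x ∂σ.toJordanDecomposition.posPart
      - ∫ x, f x ∂σ.toJordanDecomposition.negPart := by
  conv_lhs => rw [← SignedMeasure.toSignedMeasure_toJordanDecomposition σ]
  rw [JordanDecomposition.toSignedMeasure, sintegral_sub_measure, sintegral_toSignedMeasure,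
    sintegral_toSignedMeasure]
  · exact integrable_of_abs_le hf.aestronglyMeasurable C h
  · exact integrable_of_abs_le hf.aestronglyMeasurable C h

lemma cintegral_indicator (κ : ComplexMeasure Torus) (c : ℂ) {s : Set Torus}
    (hs : MeasurableSet s) : cintegral κ (s.indicator fun _ => c) = c * κ s := by
  rw [cintegral, VectorMeasure.integral_eq_setToFun, setToFun_indicator_const _ hs (by finiteness)]
  rfl

lemma sintegral_indicator (σ : SignedMeasure Torus) (c : ℝ) {s : Set Torus}
    (hs : MeasurableSet s) : sintegral σ (s.indicator fun _ => c) = c * σ s := by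
  rw [sintegral, VectorMeasure.integral_eq_setToFun, setToFun_indicator_const _ hs (by finiteness)]
  rfl

/-- Supplies the closedness step of the `L¹` induction in `cintegral_eq`. -/
lemma continuous_sintegral_comp {κ : ComplexMeasure Torus} {σ : SignedMeasure Torus}
    (hσ : σ.variation ≤ κ.variation) (L : ℂ →L[ℝ] ℝ) :
    Continuous fun f : Torus →₁[κ.variation] ℂ => sintegral σ fun x => L (f x) := by
  rw [continuous_iff_continuousAt]
  intro f
  refine VectorMeasure.tendsto_integral_of_L1 _
    (L.continuous.comp_aestronglyMeasurable ((Lp.aestronglyMeasurable f).mono_measure hσ))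
    (Filter.Eventually.of_forall fun g => ?_) ?_
  · exact (L.integrable_comp (L1.integrable_coeFn g)).mono_measure hσ
  · have h0 : Filter.Tendsto (fun g : Torus →₁[κ.variation] ℂ => ‖L‖ₑ * edist g f) (nhds f)
        (nhds 0) := by
      have h1 : Filter.Tendsto (fun g : Torus →₁[κ.variation] ℂ => edist g f) (nhds f)
          (nhds 0) := tendsto_iff_edist_tendsto_0.1 Filter.tendsto_id
      simpa using ENNReal.Tendsto.const_mul h1 (Or.inr (by simp : ‖L‖ₑ ≠ ∞))
    refine tendsto_of_tendsto_of_tendsto_of_le_of_le tendsto_const_nhds h0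
      (fun _ => zero_le) fun g => ?_
    calc ∫⁻ x, ‖L (g x) - L (f x)‖ₑ ∂σ.variation
        ≤ ∫⁻ x, ‖L‖ₑ * ‖g x - f x‖ₑ ∂σ.variation := by
          refine lintegral_mono fun x => ?_
          rw [← map_sub]
          exact L.le_opENorm _
      _ ≤ ∫⁻ x, ‖L‖ₑ * ‖g x - f x‖ₑ ∂κ.variation := lintegral_mono' hσ le_rfl
      _ = ‖L‖ₑ * ∫⁻ x, ‖g x - f x‖ₑ ∂κ.variation := lintegral_const_mul' _ _ (by simp)
      _ = ‖L‖ₑ * edist g f := by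
          rw [L1.edist_def]
          simp [edist_eq_enorm_sub]

/-- Both sides agree on indicators, are additive and are continuous in `L¹`, so induction on
integrable functions applies. Complex integrals are reduced to real ones through this identity. -/
lemma cintegral_eq (κ : ComplexMeasure Torus) {f : Torus → ℂ} (hf : Integrable f κ.variation) :
    cintegral κ f =
      ⟨sintegral (ComplexMeasure.re κ) (fun x => (f x).re)
        - sintegral (ComplexMeasure.im κ) (fun x => (f x).im),
       sintegral (ComplexMeasure.re κ) (fun x => (f x).im)
        + sintegral (ComplexMeasure.im κ) (fun x => (f x).re)⟩ := by
  have hr := variation_re_le κ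
  have hi := variation_im_le κ
  refine Integrable.induction (fun f : Torus → ℂ => cintegral κ f =
      ⟨sintegral (ComplexMeasure.re κ) (fun x => (f x).re)
        - sintegral (ComplexMeasure.im κ) (fun x => (f x).im),
       sintegral (ComplexMeasure.re κ) (fun x => (f x).im)
        + sintegral (ComplexMeasure.im κ) (fun x => (f x).re)⟩) ?_ ?_ ?_ ?_ hf
  · intro c s hs _
    have h1 : (fun x => (s.indicator (fun _ => c) x).re) = s.indicator fun _ => c.re := by
      ext x; by_cases hx : x ∈ s <;> simp [hx]
    have h2 : (fun x => (s.indicator (fun _ => c) x).im) = s.indicator fun _ => c.im := by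
      ext x; by_cases hx : x ∈ s <;> simp [hx]
    rw [h1, h2, cintegral_indicator _ _ hs]
    simp only [sintegral_indicator _ _ hs]
    apply Complex.ext
    · simp [Complex.mul_re]
      rfl
    · simp [Complex.mul_im]
      exact add_comm _ _
  · intro f g _ hf hg ihf ihg
    have h : cintegral κ (f + g) = cintegral κ f + cintegral κ g :=
      VectorMeasure.integral_fun_add hf hg
    have ir : ∀ {k : Torus → ℂ} {σ : SignedMeasure Torus}, Integrable k κ.variation →
        σ.variation ≤ κ.variation → Integrable (fun x => (k x).re) σ.variation :=
      fun hk hσ => (hk.mono_measure hσ).re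
    have ii : ∀ {k : Torus → ℂ} {σ : SignedMeasure Torus}, Integrable k κ.variation →
        σ.variation ≤ κ.variation → Integrable (fun x => (k x).im) σ.variation :=
      fun hk hσ => (hk.mono_measure hσ).im
    rw [h, ihf, ihg]
    simp only [Pi.add_apply, Complex.add_re, Complex.add_im]
    rw [sintegral_add _ (ir hf hr) (ir hg hr), sintegral_add _ (ii hf hr) (ii hg hr),
      sintegral_add _ (ir hf hi) (ir hg hi), sintegral_add _ (ii hf hi) (ii hg hi)]
    apply Complex.ext <;> simp <;> ring
  · refine isClosed_eq VectorMeasure.continuous_integral ?_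
    have c1 := continuous_sintegral_comp hr Complex.reCLM
    have c2 := continuous_sintegral_comp hr Complex.imCLM
    have c3 := continuous_sintegral_comp hi Complex.reCLM
    have c4 := continuous_sintegral_comp hi Complex.imCLM
    simp only [Complex.reCLM_apply, Complex.imCLM_apply] at c1 c2 c3 c4
    exact Complex.equivRealProdCLM.symm.continuous.comp ((c1.sub c4).prodMk (c2.add c3))
  · intro f g hfg _ ih
    have h : cintegral κ f = cintegral κ g := VectorMeasure.integral_congr_ae hfg
    have h' : ∀ {σ : SignedMeasure Torus} (_ : σ.variation ≤ κ.variation) (L : ℂ → ℝ),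
        sintegral σ (fun x => L (f x)) = sintegral σ (fun x => L (g x)) := fun hσ L =>
      VectorMeasure.integral_congr_ae
        (Filter.Eventually.mono (ae_mono hσ hfg) fun x hx => congrArg L hx)
    rw [← h, ih, h' hr Complex.re, h' hr Complex.im, h' hi Complex.re, h' hi Complex.im]

lemma re_ofReal (σ : SignedMeasure Torus) : ComplexMeasure.re (ofReal σ) = σ := rfl

lemma im_ofReal (σ : SignedMeasure Torus) : ComplexMeasure.im (ofReal σ) = 0 := rfl

lemma ofReal_sub (ν μ : SignedMeasure Torus) : ofReal (ν - μ) = ofReal ν - ofReal μ := by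
  ext s hs
  apply Complex.ext <;> simp [ofReal, SignedMeasure.toComplexMeasure_apply]

lemma sintegral_zero_measure (f : Torus → ℝ) : sintegral 0 f = 0 :=
  VectorMeasure.integral_zero_vectorMeasure

lemma sintegral_withDensity {h : Torus → ℝ} (hh : Continuous h) {f : Torus → ℝ}
    (hf : Measurable f) (C : ℝ) (hC : ∀ x, ‖f x‖ ≤ C) :
    sintegral (volume.withDensityᵥ h) f = ∫ x, f x * h x := by
  have hi : Integrable h := hh.integrable_of_hasCompactSupport (HasCompactSupport.of_compactSpace h)
  have : IsFiniteMeasure ((volume : Measure Torus).withDensity fun x => ENNReal.ofReal (h x)) :=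
    isFiniteMeasure_withDensity_ofReal hi.2
  have : IsFiniteMeasure ((volume : Measure Torus).withDensity fun x => ENNReal.ofReal (-h x)) :=
    isFiniteMeasure_withDensity_ofReal hi.neg.2
  have hfb : ∀ m : Measure Torus, IsFiniteMeasure m → Integrable f m := fun m _ =>
    integrable_of_abs_le hf.aestronglyMeasurable C hC
  rw [withDensityᵥ_eq_withDensity_pos_part_sub_withDensity_neg_part hi, sintegral_sub_measure,
    sintegral_toSignedMeasure, sintegral_toSignedMeasure]
  · have e : ∀ k : Torus → ℝ, Continuous k →
        ∫ x, f x ∂((volume : Measure Torus).withDensity fun x => ENNReal.ofReal (k x))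
          = ∫ x, f x * max (k x) 0 := fun k hk => by
      rw [integral_withDensity_eq_integral_toReal_smul (by fun_prop) (by simp)]
      refine integral_congr_ae (Filter.Eventually.of_forall fun x => ?_)
      simp [ENNReal.toReal_ofReal', mul_comm]
    have i : ∀ k : Torus → ℝ, Continuous k → Integrable fun x => f x * max (k x) 0 := fun k hk =>
      ((hk.max continuous_const).integrable_of_hasCompactSupport
        (HasCompactSupport.of_compactSpace _)).bdd_mul hf.aestronglyMeasurable
        (Filter.Eventually.of_forall hC)
    rw [e h hh, e (fun x => -h x) hh.neg, ← integral_sub (i h hh) (i (fun x => -h x) hh.neg)]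
    refine integral_congr_ae (Filter.Eventually.of_forall fun x => ?_)
    simp only
    rw [← mul_sub]
    congr 1
    rcases le_total 0 (h x) with h0 | h0
    · rw [max_eq_left h0, max_eq_right (by linarith)]; ring
    · rw [max_eq_right h0, max_eq_left (by linarith)]; ring
  · exact hfb _ inferInstance
  · exact hfb _ inferInstance

/-! ### The Bernoulli spline and Lipschitz functions on the torus -/

instance isProbabilityMeasure_torus : IsProbabilityMeasure (volume : Measure Torus) :=
  ⟨UnitAddCircle.measure_univ⟩

lemma bernoulliSpline_coe {s : ℝ} (h0 : 0 < s) (h1 : s < 1) :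
    bernoulliSpline (s : Torus) = 1 / 2 - s := by
  have hs : s ∈ Set.Ico (0 : ℝ) (0 + 1) := ⟨h0.le, by linarith⟩
  have hne : (s : Torus) ≠ 0 := by
    intro h
    have h2 : (s : Torus) = ((0 : ℝ) : Torus) := by simpa using h
    exact h0.ne' ((AddCircle.coe_eq_coe_iff_of_mem_Ico hs ⟨le_rfl, by norm_num⟩).1 h2)
  rw [bernoulliSpline, if_neg hne, AddCircle.equivIco_coe_eq hs]

lemma bernoulliSpline_coe_neg {s : ℝ} (h0 : -1 < s) (h1 : s < 0) :
    bernoulliSpline (s : Torus) = -1 / 2 - s := by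
  have h : (s : Torus) = ((s + 1 : ℝ) : Torus) := by simp
  rw [h, bernoulliSpline_coe (by linarith) (by linarith)]
  ring

lemma exists_rep (x : Torus) : ∃ s : ℝ, 0 ≤ s ∧ s < 1 ∧ (s : Torus) = x := by
  refine ⟨AddCircle.equivIco 1 0 x, (AddCircle.equivIco 1 0 x).2.1, ?_, AddCircle.coe_equivIco⟩
  simpa using (AddCircle.equivIco 1 0 x).2.2

lemma bernoulliSpline_neg (x : Torus) : bernoulliSpline (-x) = -bernoulliSpline x := by
  obtain ⟨s, h0, h1, rfl⟩ := exists_rep x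
  rcases h0.eq_or_lt with rfl | h0
  · simp [bernoulliSpline]
  · have : -(s : Torus) = ((-s : ℝ) : Torus) := by simp
    rw [this, bernoulliSpline_coe h0 h1, bernoulliSpline_coe_neg (by linarith) (by linarith)]
    ring

lemma abs_bernoulliSpline_le (x : Torus) : |bernoulliSpline x| ≤ 1 / 2 := by
  obtain ⟨s, h0, h1, rfl⟩ := exists_rep x
  rcases h0.eq_or_lt with rfl | h0
  · simp [bernoulliSpline]
  · rw [bernoulliSpline_coe h0 h1, abs_le]
    constructor <;> linarith

@[fun_prop]
lemma measurable_bernoulliSpline : Measurable bernoulliSpline := by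
  refine Measurable.ite (measurableSet_singleton 0) measurable_const ?_
  exact measurable_const.sub
    (measurable_subtype_coe.comp (AddCircle.measurableEquivIco 1 0).measurable)

lemma continuousAt_bernoulliSpline {x : Torus} (hx : x ≠ 0) : ContinuousAt bernoulliSpline x := by
  have h1 : ContinuousAt (fun y : Torus => 1 / 2 - (AddCircle.equivIco 1 0 y : ℝ)) x :=
    continuousAt_const.sub
      (continuous_subtype_val.continuousAt.comp (AddCircle.continuousAt_equivIco 1 0 (by simpa using hx)))
  refine h1.congr ?_
  filter_upwards [isOpen_ne.mem_nhds hx] with y hy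
  rw [bernoulliSpline, if_neg hy]

/-- Lifts at minimal distance let Lipschitz bounds descend from the line to the torus. -/
lemma exists_real_rep (x y : Torus) : ∃ s t : ℝ, (s : Torus) = x ∧ (t : Torus) = y ∧
    |s - t| = dist x y := by
  obtain ⟨t, -, -, rfl⟩ := exists_rep y
  obtain ⟨s, -, -, rfl⟩ := exists_rep x
  refine ⟨s - round (s - t), t, ?_, rfl, ?_⟩
  · simp
  · rw [dist_eq_norm, ← AddCircle.coe_sub, UnitAddCircle.norm_eq]
    congr 1; ring

lemma dist_coe_le (s t : ℝ) : dist (s : Torus) (t : Torus) ≤ |s - t| := by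
  rw [dist_eq_norm, ← AddCircle.coe_sub, UnitAddCircle.norm_eq]
  simpa using round_le (s - t) 0

lemma lipschitzWith_of_lift {E : Type*} [PseudoMetricSpace E] {K : NNReal} {f : Torus → E}
    (h : LipschitzWith K fun s : ℝ => f s) : LipschitzWith K f := by
  refine LipschitzWith.of_dist_le_mul fun x y => ?_
  obtain ⟨s, t, rfl, rfl, hst⟩ := exists_real_rep x y
  rw [← hst, ← Real.dist_eq]
  exact h.dist_le_mul s t

lemma lift_lipschitzWith {E : Type*} [PseudoMetricSpace E] {K : NNReal} {f : Torus → E}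
    (h : LipschitzWith K f) : LipschitzWith K fun s : ℝ => f s := by
  refine LipschitzWith.of_dist_le_mul fun s t => (h.dist_le_mul s t).trans ?_
  rw [Real.dist_eq]
  gcongr
  exact dist_coe_le s t

/-- The convolution `∫ 𝓑₁(x - t) g(t) dt` with a density. -/
def splineConv (g : Torus → ℝ) (x : Torus) : ℝ := ∫ t, bernoulliSpline (x - t) * g t

/-- On the period `(s - 1, s)` the argument `s - t` stays in `(0, 1)`, where the spline is affine;
the jump at `t = s` is a null set. -/
lemma splineConv_coe (g : Torus → ℝ) (s : ℝ) :
    splineConv g s = ∫ t in (s - 1)..s, (1 / 2 - s + t) * g t := by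
  rw [splineConv, ← UnitAddCircle.intervalIntegral_preimage (s - 1), sub_add_cancel]
  have h : ∀ᵐ t : ℝ, t ≠ s := by simp [ae_iff, measure_singleton]
  refine intervalIntegral.integral_congr_ae ?_
  filter_upwards [h] with t ht hmem
  rw [Set.uIoc_of_le (by linarith)] at hmem
  rw [← AddCircle.coe_sub, bernoulliSpline_coe (by linarith [lt_of_le_of_ne hmem.2 ht])
    (by linarith [hmem.1])]
  ring

/-- Every real function with Lipschitz constant `1` is a constant plus the convolution of the
spline with a density `g` of mean zero with `|g| ≤ 1`. -/
lemma exists_density_of_lipschitz {f : Torus → ℝ} (hf : LipschitzWith 1 f) :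
    ∃ g : Torus → ℝ, Measurable g ∧ (∀ t, |g t| ≤ 1) ∧ ∫ t, g t = 0 ∧
      ∀ x, f x = (∫ t, f t) + splineConv g x := by
  set F : ℝ → ℝ := fun s => f s with hF
  have hFL : LipschitzWith 1 F := lift_lipschitzWith hf
  have hper : Function.Periodic F 1 := fun s => by simp [hF]
  have hdper : Function.Periodic (deriv F) 1 := fun s => by
    rw [← deriv_comp_add_const]
    congr 1
    exact funext hper
  have hac : ∀ a b : ℝ, AbsolutelyContinuousOnInterval F a b := fun a b =>
    (hFL.lipschitzOnWith).absolutelyContinuousOnInterval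
  -- The density is the derivative of the lift; absolute continuity provides the fundamental theorem
  -- of calculus and integration by parts.
  refine ⟨hdper.lift, ?_, ?_, ?_, ?_⟩
  · have : (hdper.lift : Torus → ℝ) = fun x => deriv F (AddCircle.equivIco 1 0 x : ℝ) := by
      ext x
      conv_lhs => rw [← AddCircle.coe_equivIco (p := 1) (a := 0) (y := x)]
      rfl
    rw [this]
    exact (measurable_deriv F).comp
      (measurable_subtype_coe.comp (AddCircle.measurableEquivIco 1 0).measurable)
  · intro t
    obtain ⟨s, -, -, rfl⟩ := exists_rep t
    simpa using norm_deriv_le_of_lipschitz (x₀ := s) hFL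
  · rw [← UnitAddCircle.intervalIntegral_preimage 0]
    have := (hac 0 (0 + 1)).integral_deriv_eq_sub
    simp only [Function.Periodic.lift_coe]
    rw [this, hper, sub_self]
  · intro x
    obtain ⟨s, -, -, rfl⟩ := exists_rep x
    rw [splineConv_coe, ← UnitAddCircle.intervalIntegral_preimage (s - 1), sub_add_cancel]
    have hid : AbsolutelyContinuousOnInterval (fun t : ℝ => 1 / 2 - s + t) (s - 1) s :=
      (LipschitzWith.of_dist_le_mul (K := 1) fun a b => by simp).lipschitzOnWith.absolutelyContinuousOnInterval
    -- The affine kernel equals `1/2` at `s` and `-1/2` at `s - 1`, so by periodicity the boundary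
    -- terms add up to `F s`, and the remaining term is minus the mean of `f`.
    have key := hid.integral_mul_deriv_eq_deriv_mul (hac (s - 1) s)
    simp only [Function.Periodic.lift_coe]
    rw [key]
    have h2 : F (s - 1) = F s := by
      have := hper (s - 1); rw [sub_add_cancel] at this; exact this.symm
    have h3 : ∀ t : ℝ, deriv (fun t : ℝ => 1 / 2 - s + t) t = 1 := fun t => by simp
    simp only [h3, one_mul, h2]
    simp only [hF]
    ring

lemma intervalIntegrable_of_abs_le {h : ℝ → ℝ} (hh : Measurable h) {C : ℝ} (hC : ∀ t, |h t| ≤ C)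
    (a b : ℝ) : IntervalIntegrable h volume a b :=
  (intervalIntegrable_const (c := C)).mono_fun hh.aestronglyMeasurable
    (Filter.Eventually.of_forall fun t => (hC t).trans (le_abs_self C))

/-- Mean zero reduces the convolution at `s` to the integral of `t * g t` over `(s - 1, s)`. Moving
this window from `x` to `y` adds `t * g t` over `(x, y)` and removes `(t - 1) * g t` there, leaving
`g`. -/
lemma splineConv_sub {g : Torus → ℝ} (hg : Measurable g) (hb : ∀ t, |g t| ≤ 1)
    (h0 : ∫ t, g t = 0) (x y : ℝ) :
    splineConv g y - splineConv g x = ∫ t in x..y, g t := by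
  have hgm : Measurable fun t : ℝ => g t := hg.comp AddCircle.measurable_mk'
  have hgi : ∀ a b : ℝ, IntervalIntegrable (fun t : ℝ => g t) volume a b :=
    intervalIntegrable_of_abs_le hgm fun t => hb t
  have hti : ∀ a b : ℝ, IntervalIntegrable (fun t : ℝ => t * g t) volume a b := fun a b =>
    (hgi a b).continuousOn_mul continuous_id.continuousOn
  have hS : ∀ s : ℝ, splineConv g s = ∫ t in (s - 1)..s, t * g t := by
    intro s
    have h1 : ∫ t in (s - 1)..s, g (t : ℝ) = 0 := by
      have := UnitAddCircle.intervalIntegral_preimage (s - 1) g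
      rw [sub_add_cancel] at this
      rw [this, h0]
    rw [splineConv_coe]
    calc ∫ t in (s - 1)..s, (1 / 2 - s + t) * g t
        = ∫ t in (s - 1)..s, ((1 / 2 - s) * g t + t * g t) := by
          congr 1; ext t; ring
      _ = _ := by
          rw [intervalIntegral.integral_add ((hgi _ _).const_mul _) (hti _ _),
            intervalIntegral.integral_const_mul, h1, mul_zero, zero_add]
  have hshift : ∫ t in (x - 1)..(y - 1), t * g (t : ℝ) = ∫ t in x..y, (t - 1) * g (t : ℝ) := by
    rw [← intervalIntegral.integral_comp_sub_right (fun t : ℝ => t * g t) 1]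
    have hone : ((1 : ℝ) : Torus) = 0 := AddCircle.coe_period 1
    simp [hone]
  have h3 : ∫ t in x..y, (t - 1) * g (t : ℝ) =
      (∫ t in x..y, t * g (t : ℝ)) - ∫ t in x..y, g (t : ℝ) := by
    rw [← intervalIntegral.integral_sub (hti _ _) (hgi _ _)]
    congr 1; ext t; ring
  have h4 := intervalIntegral.integral_add_adjacent_intervals (hti (x - 1) x) (hti x y)
  have h5 := intervalIntegral.integral_add_adjacent_intervals (hti (x - 1) (y - 1)) (hti (y - 1) y)
  rw [hS, hS]
  linarith

lemma lipschitzWith_splineConv {g : Torus → ℝ} (hg : Measurable g) (hb : ∀ t, |g t| ≤ 1)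
    (h0 : ∫ t, g t = 0) : LipschitzWith 1 (splineConv g) := by
  refine lipschitzWith_of_lift (LipschitzWith.of_dist_le_mul fun x y => ?_)
  rw [dist_comm, dist_comm x y, Real.dist_eq, Real.dist_eq, splineConv_sub hg hb h0]
  exact intervalIntegral.norm_integral_le_of_norm_le_const (f := fun t : ℝ => g t) (C := 1)
    fun t _ => hb t

/-! ### Convolution of a measure with the spline -/

lemma bernoulliConv_eq_sintegral (σ : SignedMeasure Torus) (t : Torus) :
    bernoulliConv σ t = sintegral σ fun x => bernoulliSpline (t - x) := rfl

lemma bernoulliConv_eq_jordan (σ : SignedMeasure Torus) (t : Torus) :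
    bernoulliConv σ t = ∫ x, bernoulliSpline (t - x) ∂σ.toJordanDecomposition.posPart
      - ∫ x, bernoulliSpline (t - x) ∂σ.toJordanDecomposition.negPart :=
  sintegral_eq_jordan σ (by fun_prop) (1 / 2) fun _ => abs_bernoulliSpline_le _

lemma bernoulliConv_sub (ν μ : SignedMeasure Torus) (t : Torus) :
    bernoulliConv (ν - μ) t = bernoulliConv ν t - bernoulliConv μ t := by
  refine sintegral_sub_measure ν μ ?_ ?_ <;>
  exact integrable_of_abs_le (Measurable.aestronglyMeasurable (by fun_prop)) (1 / 2)
    fun _ => abs_bernoulliSpline_le _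

lemma measurable_bernoulliConv (σ : SignedMeasure Torus) : Measurable (bernoulliConv σ) := by
  have h : ∀ m : Measure Torus, IsFiniteMeasure m →
      Measurable fun t => ∫ x, bernoulliSpline (t - x) ∂m := fun m _ =>
    (StronglyMeasurable.integral_prod_right (f := fun t x => bernoulliSpline (t - x))
      (Measurable.stronglyMeasurable (by fun_prop))).measurable
  have e : bernoulliConv σ = fun t => _ := funext fun t => bernoulliConv_eq_jordan σ t
  rw [e]
  exact (h _ inferInstance).sub (h _ inferInstance)

lemma exists_abs_bernoulliConv_le (σ : SignedMeasure Torus) :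
    ∃ C : ℝ, ∀ t, |bernoulliConv σ t| ≤ C :=
  ⟨_, fun t => VectorMeasure.norm_integral_le_of_norm_le_const (μ := σ)
    (f := fun x => bernoulliSpline (t - x)) (B := ContinuousLinearMap.mul ℝ ℝ)
    (Filter.Eventually.of_forall fun _ => abs_bernoulliSpline_le _)⟩

lemma integrable_bernoulliConv (σ : SignedMeasure Torus) : Integrable (bernoulliConv σ) := by
  obtain ⟨C, hC⟩ := exists_abs_bernoulliConv_le σ
  exact integrable_of_abs_le (measurable_bernoulliConv σ).aestronglyMeasurable C hC

/-- Fubini; the minus sign comes from oddness of the spline. -/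
lemma integral_splineConv (m : Measure Torus) [IsFiniteMeasure m] {g : Torus → ℝ}
    (hg : Measurable g) (hb : ∀ t, |g t| ≤ 1) :
    ∫ x, splineConv g x ∂m = -∫ t, g t * ∫ x, bernoulliSpline (t - x) ∂m := by
  have hint : Integrable (Function.uncurry fun x t : Torus => bernoulliSpline (x - t) * g t)
      (m.prod volume) := by
    refine Integrable.of_bound (C := 1 / 2) (Measurable.aestronglyMeasurable ?_)
      (Filter.Eventually.of_forall fun p => ?_)
    · exact (measurable_bernoulliSpline.comp (measurable_fst.sub measurable_snd)).mul
        (hg.comp measurable_snd)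
    · simp only [Function.uncurry, norm_mul, Real.norm_eq_abs]
      calc _ ≤ 1 / 2 * 1 := mul_le_mul (abs_bernoulliSpline_le _) (hb _) (abs_nonneg _) (by norm_num)
        _ = 1 / 2 := by norm_num
  unfold splineConv
  rw [integral_integral_swap hint, ← integral_neg]
  refine integral_congr_ae (Filter.Eventually.of_forall fun t => ?_)
  simp only
  rw [integral_mul_const, mul_comm, ← mul_neg, ← integral_neg]
  congr 2
  ext x
  rw [← bernoulliSpline_neg, neg_sub]

lemma abs_splineConv_le {g : Torus → ℝ} (hb : ∀ t, |g t| ≤ 1) (x : Torus) :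
    |splineConv g x| ≤ 1 / 2 := by
  have := norm_integral_le_of_norm_le_const (μ := (volume : Measure Torus)) (C := 1 / 2)
    (f := fun t => bernoulliSpline (x - t) * g t) (Filter.Eventually.of_forall fun t => by
      rw [norm_mul]
      calc _ ≤ 1 / 2 * 1 := mul_le_mul (abs_bernoulliSpline_le _) (hb _) (abs_nonneg _) (by norm_num)
        _ = 1 / 2 := by norm_num)
  rwa [probReal_univ, mul_one] at this

lemma sintegral_splineConv (σ : SignedMeasure Torus) {g : Torus → ℝ}
    (hg : Measurable g) (hb : ∀ t, |g t| ≤ 1) (h0 : ∫ t, g t = 0) :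
    sintegral σ (splineConv g) = -∫ t, g t * bernoulliConv σ t := by
  have hi : ∀ m : Measure Torus, IsFiniteMeasure m →
      Integrable fun t => g t * ∫ x, bernoulliSpline (t - x) ∂m := fun m _ => by
    have h1 : Measurable fun t => ∫ x, bernoulliSpline (t - x) ∂m :=
      (StronglyMeasurable.integral_prod_right (f := fun t x => bernoulliSpline (t - x))
        (Measurable.stronglyMeasurable (by fun_prop))).measurable
    refine integrable_of_abs_le (hg.mul h1).aestronglyMeasurable (1 * (1 / 2 * m.real Set.univ))
      fun t => ?_
    rw [norm_mul]
    refine mul_le_mul (hb t) ?_ (norm_nonneg _) zero_le_one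
    exact norm_integral_le_of_norm_le_const
      (Filter.Eventually.of_forall fun _ => abs_bernoulliSpline_le _)
  rw [sintegral_eq_jordan σ (lipschitzWith_splineConv hg hb h0).continuous.measurable (1 / 2)
    (abs_splineConv_le hb), integral_splineConv _ hg hb, integral_splineConv _ hg hb]
  simp only [bernoulliConv_eq_jordan, mul_sub]
  rw [integral_sub (hi _ inferInstance) (hi _ inferInstance)]
  ring

/-! ### Real and complex test functions for `W1` -/

lemma Lipschitz.integrable {E : Type*} [NormedAddCommGroup E] [SecondCountableTopology E]
    [MeasurableSpace E] [BorelSpace E] {K : NNReal} {f : Torus → E}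
    (hf : LipschitzWith K f) (m : Measure Torus) [IsFiniteMeasure m] : Integrable f m :=
  hf.continuous.integrable_of_hasCompactSupport (HasCompactSupport.of_compactSpace f)

/-- A combination `a f₀ - i b f₁` of real `1`-Lipschitz functions tests a complex measure. -/
lemma ofReal_le_W1 (ν μ : ComplexMeasure Torus) {f₀ f₁ : Torus → ℝ} (h₀ : LipschitzWith 1 f₀)
    (h₁ : LipschitzWith 1 f₁) {a b : ℝ} (hab : a ^ 2 + b ^ 2 ≤ 1) :
    ENNReal.ofReal (a * sintegral (ComplexMeasure.re (ν - μ)) f₀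
      + b * sintegral (ComplexMeasure.im (ν - μ)) f₁) ≤ W1 ν μ := by
  -- Integrating `a f₀ - i b f₁` against a complex measure has exactly the required combination as
  -- real part, and `a ^ 2 + b ^ 2 ≤ 1` keeps the Lipschitz constant at most `1`.
  set f : Torus → ℂ := fun x => ⟨a * f₀ x, -b * f₁ x⟩ with hf
  have hL : LipschitzWith 1 f := by
    refine LipschitzWith.of_dist_le_mul fun x y => ?_
    have e0 := h₀.dist_le_mul x y
    have e1 := h₁.dist_le_mul x y
    rw [Real.dist_eq] at e0 e1
    rw [Complex.dist_eq]
    refine abs_le_of_sq_le_sq' ?_ (by positivity) |>.2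
    rw [Complex.sq_norm, Complex.normSq_apply]
    simp only [hf, Complex.sub_re, Complex.sub_im, NNReal.coe_one, one_mul] at e0 e1 ⊢
    have s0 := sq_le_sq' (by linarith [abs_nonneg (f₀ x - f₀ y), dist_nonneg (x := x) (y := y)]) e0
    have s1 := sq_le_sq' (by linarith [abs_nonneg (f₁ x - f₁ y), dist_nonneg (x := x) (y := y)]) e1
    rw [sq_abs] at s0 s1
    nlinarith [mul_le_mul_of_nonneg_left s0 (sq_nonneg a), mul_le_mul_of_nonneg_left s1 (sq_nonneg b),
      mul_le_mul_of_nonneg_right hab (sq_nonneg (dist x y))]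
  have hle : ‖cintegral (ν - μ) f‖ₑ ≤ W1 ν μ := le_iSup₂ (f := fun (f : Torus → ℂ)
    (_ : LipschitzWith 1 f) => ‖cintegral (ν - μ) f‖ₑ) f hL
  refine le_trans ?_ hle
  rw [← ofReal_norm]
  refine ENNReal.ofReal_le_ofReal (le_trans (le_of_eq ?_) (Complex.re_le_norm _))
  rw [cintegral_eq _ (Lipschitz.integrable hL _)]
  simp only [hf, sintegral_const_mul]
  ring

/-- For real measures, real `1`-Lipschitz functions suffice to bound the distance. -/
lemma W1_ofReal_le (ν μ : SignedMeasure Torus) {M : ℝ}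
    (h : ∀ f : Torus → ℝ, LipschitzWith 1 f → sintegral (ν - μ) f ≤ M) :
    W1 (ofReal ν) (ofReal μ) ≤ ENNReal.ofReal M := by
  refine iSup₂_le fun f hf => ?_
  rw [← ofReal_norm]
  refine ENNReal.ofReal_le_ofReal ?_
  rw [← ofReal_sub]
  set z := cintegral (ofReal (ν - μ)) f with hz
  -- Rotation by the conjugate phase of `z` makes the integral equal to its modulus, so the real
  -- part of `u * f` tests the measure just as well.
  obtain ⟨u, hu, huz⟩ : ∃ u : ℂ, ‖u‖ = 1 ∧ (u * z).re = ‖z‖ := by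
    rcases eq_or_ne z 0 with h0 | h0
    · exact ⟨1, by simp, by simp [h0]⟩
    · have hn : ‖z‖ ≠ 0 := by simpa using h0
      refine ⟨(starRingEnd ℂ) z / ‖z‖, by simp [hn], ?_⟩
      have : (starRingEnd ℂ) z / (‖z‖ : ℂ) * z = ((‖z‖ : ℝ) : ℂ) := by
        have h2 : (starRingEnd ℂ) z * z = (‖z‖ : ℂ) ^ 2 := by
          rw [mul_comm, Complex.mul_conj, Complex.normSq_eq_norm_sq]; push_cast; rfl
        have hn' : (‖z‖ : ℂ) ≠ 0 := by exact_mod_cast hn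
        rw [div_mul_eq_mul_div, h2]
        field_simp
      rw [this, Complex.ofReal_re]
  have hfr : LipschitzWith 1 fun x => (u * f x).re := by
    refine LipschitzWith.of_dist_le_mul fun x y => ?_
    rw [Real.dist_eq, ← Complex.sub_re, ← mul_sub]
    refine (Complex.abs_re_le_norm _).trans ?_
    rw [norm_mul, hu, one_mul, ← dist_eq_norm]
    exact hf.dist_le_mul x y
  have hfi := Lipschitz.integrable hf
  have e : (u * z).re = sintegral (ν - μ) fun x => (u * f x).re := by
    have e1 : (fun x => (u * f x).re) = fun x => u.re * (f x).re + -u.im * (f x).im := by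
      ext x; rw [Complex.mul_re]; ring
    have ir : Integrable (fun x => u.re * (f x).re) (ν - μ).variation :=
      Integrable.const_mul (hfi _).re _
    have ii : Integrable (fun x => -u.im * (f x).im) (ν - μ).variation :=
      Integrable.const_mul (hfi _).im _
    rw [e1, sintegral_add _ ir ii, sintegral_const_mul, sintegral_const_mul, hz,
      cintegral_eq _ (hfi _), Complex.mul_re]
    simp only [re_ofReal, im_ofReal, sintegral_zero_measure]
    ring
  rw [← huz, e]
  exact h _ hfr

/-! ### Medians and their dual characterisation -/

section Median

variable {F : Torus → ℝ}

/-- `m` is a median of `F`. -/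
def IsMedian (F : Torus → ℝ) (m : ℝ) : Prop :=
  volume {t | m < F t} ≤ 1 / 2 ∧ volume {t | F t < m} ≤ 1 / 2

/-- The infimum of the levels exceeded with measure at most `1/2` is a median; both inequalities
pass to the limit by continuity of the measure along increasing unions. -/
lemma exists_isMedian (hF : Measurable F) {C : ℝ} (hC : ∀ t, |F t| ≤ C) :
    ∃ m, IsMedian F m := by
  set S : Set ℝ := {c | volume {t | c < F t} ≤ 1 / 2} with hS
  have hup : C ∈ S := by
    have : {t | C < F t} = ∅ := by
      ext t; simpa using (le_abs_self _).trans (hC t)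
    simp [hS, this]
  have hlow : ∀ c ∈ S, -C ≤ c := by
    intro c hc
    by_contra h
    push Not at h
    have : {t | c < F t} = Set.univ := by
      ext t; simpa using h.trans_le (neg_le_of_abs_le (hC t))
    rw [hS, Set.mem_ofPred_eq, this, measure_univ] at hc
    exact absurd hc (by simp)
  have hbdd : BddBelow S := ⟨-C, hlow⟩
  have hmono : ∀ c ∈ S, ∀ d, c ≤ d → d ∈ S := fun c hc d hcd =>
    (measure_mono fun t (ht : d < F t) => hcd.trans_lt ht).trans hc
  have habove : ∀ d, sInf S < d → d ∈ S := fun d hd => by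
    obtain ⟨c, hc, hcd⟩ := exists_lt_of_csInf_lt ⟨C, hup⟩ hd
    exact hmono c hc d hcd.le
  obtain ⟨u, hua, hu, hut⟩ := exists_seq_strictAnti_tendsto (sInf S)
  obtain ⟨l, hla, hl, hlt⟩ := exists_seq_strictMono_tendsto (sInf S)
  refine ⟨sInf S, ?_, ?_⟩
  · have hun : {t | sInf S < F t} = ⋃ n, {t | u n < F t} := by
      ext t
      simp only [Set.mem_ofPred_eq, Set.mem_iUnion]
      exact ⟨fun h => (hut.eventually_lt_const h).exists, fun ⟨n, hn⟩ => (hu n).trans hn⟩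
    rw [hun, (Monotone.directed_le fun i j hij t (ht : u i < F t) =>
      (hua.antitone hij).trans_lt ht : Directed (· ⊆ ·) fun n => {t | u n < F t}).measure_iUnion]
    exact iSup_le fun n => habove _ (hu n)
  · have hun : {t | F t < sInf S} = ⋃ n, {t | F t ≤ l n} := by
      ext t
      simp only [Set.mem_ofPred_eq, Set.mem_iUnion]
      exact ⟨fun h => ((hlt.eventually_const_lt h).exists).imp fun n hn => hn.le,
        fun ⟨n, hn⟩ => hn.trans_lt (hl n)⟩
    rw [hun, (Monotone.directed_le fun i j hij t (ht : F t ≤ l i) =>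
      ht.trans (hla.monotone hij) : Directed (· ⊆ ·) fun n => {t | F t ≤ l n}).measure_iUnion]
    refine iSup_le fun n => ?_
    have hn : l n ∉ S := fun h => absurd (csInf_le hbdd h) (not_le.2 (hl n))
    have hn' : 1 / 2 < volume {t | l n < F t} := not_le.1 hn
    have hc : {t | F t ≤ l n} = {t | l n < F t}ᶜ := by ext; simp
    rw [hc, prob_compl_eq_one_sub (measurableSet_lt measurable_const hF)]
    calc (1 : ℝ≥0∞) - volume {t | l n < F t} ≤ 1 - 1 / 2 := tsub_le_tsub_left hn'.le _
      _ = 1 / 2 := by simp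

/-- At a median `m` there is a mean-zero density `g`, `|g| ≤ 1`, with `g (F - m) = |F - m|`. -/
lemma IsMedian.exists_sign {m : ℝ} (hF : Measurable F) (hm : IsMedian F m) :
    ∃ g : Torus → ℝ, Measurable g ∧ (∀ t, |g t| ≤ 1) ∧ ∫ t, g t = 0 ∧
      ∀ t, g t * (F t - m) = |F t - m| := by
  set P : Set Torus := {t | m < F t} with hP
  set N : Set Torus := {t | F t < m} with hN
  have mP : MeasurableSet P := measurableSet_lt measurable_const hF
  have mN : MeasurableSet N := measurableSet_lt hF measurable_const
  set Z : Set Torus := (P ∪ N)ᶜ with hZ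
  have mZ : MeasurableSet Z := (mP.union mN).compl
  have hdisj : Disjoint P N := Set.disjoint_left.2 fun t (h1 : m < F t) (h2 : F t < m) => lt_asymm h1 h2
  have toR : ∀ s : Set Torus, volume s ≤ 1 / 2 → volume.real s ≤ 1 / 2 := fun s hs => by
    have := ENNReal.toReal_mono (by simp) hs
    simpa [Measure.real] using this
  have hp := toR P hm.1
  have hn := toR N hm.2
  have hz : volume.real Z = 1 - (volume.real P + volume.real N) := by
    rw [hZ, probReal_compl_eq_one_sub (mP.union mN), measureReal_union hdisj mN]
  -- The value on `{F = m}` that makes the mean vanish; `|s| ≤ 1` is where the median property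
  -- enters. If `Z` is null then `s = 0` by division by zero, which is right because `P` and `N`
  -- then both have measure `1/2`.
  set s : ℝ := (volume.real N - volume.real P) / volume.real Z with hs
  have hs1 : |s| ≤ 1 := by
    rcases eq_or_ne (volume.real Z) 0 with h0 | h0
    · simp [hs, h0]
    · have hpos : 0 < volume.real Z := lt_of_le_of_ne measureReal_nonneg (Ne.symm h0)
      rw [hs, abs_div, abs_of_pos hpos, div_le_one hpos, abs_le]
      constructor <;> linarith
  have hsz : s * volume.real Z = volume.real N - volume.real P := by
    rcases eq_or_ne (volume.real Z) 0 with h0 | h0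
    · rw [h0, mul_zero]; linarith
    · rw [hs, div_mul_cancel₀ _ h0]
  refine ⟨fun t => P.indicator (fun _ => 1) t - N.indicator (fun _ => 1) t
    + Z.indicator (fun _ => s) t, ?_, ?_, ?_, ?_⟩
  · exact ((measurable_const.indicator mP).sub (measurable_const.indicator mN)).add
      (measurable_const.indicator mZ)
  · intro t
    by_cases h1 : t ∈ P
    · have h2 : t ∉ N := Set.disjoint_left.1 hdisj h1
      simp [h1, h2, hZ]
    · by_cases h2 : t ∈ N <;> simp [h1, h2, hZ, hs1]
  · have i : ∀ (A : Set Torus) (c : ℝ), MeasurableSet A →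
        Integrable (A.indicator fun _ => c) (volume : Measure Torus) :=
      fun A c hA => (integrable_const c).indicator hA
    have i' : Integrable (fun t => P.indicator (fun _ => (1 : ℝ)) t - N.indicator (fun _ => 1) t)
        (volume : Measure Torus) := (i P 1 mP).sub (i N 1 mN)
    beta_reduce
    rw [integral_add i' (i Z s mZ), integral_sub (i P 1 mP) (i N 1 mN),
      integral_indicator_const _ mP, integral_indicator_const _ mN, integral_indicator_const _ mZ]
    simp only [smul_eq_mul]
    linarith
  · intro t
    by_cases h1 : t ∈ P
    · have h2 : t ∉ N := Set.disjoint_left.1 hdisj h1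
      have h3 : m < F t := h1
      simp [h1, h2, hZ, abs_of_pos (sub_pos.2 h3)]
    · by_cases h2 : t ∈ N
      · have h3 : F t < m := h2
        simp [h1, h2, hZ, abs_of_neg (sub_neg.2 h3)]
      · have h3 : F t = m := le_antisymm (not_lt.1 h1) (not_lt.1 h2)
        simp [h3]

/-- If `{F > 0}` had measure above `1/2`, so would `{F ≥ δ}` for some `δ > 0`. Subtracting `δ`
lowers `|F|` by `δ` on that set and raises it by at most `δ` elsewhere, a net decrease of the
integral. -/
lemma volume_lt_le_half_of_integral_le (hF : Measurable F) (hFi : Integrable F)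
    (h : ∀ c : ℝ, ∫ t, |F t| ≤ ∫ t, |F t - c|) : volume {t | 0 < F t} ≤ 1 / 2 := by
  by_contra hc
  push Not at hc
  obtain ⟨u, hua, hu, hut⟩ := exists_seq_strictAnti_tendsto (0 : ℝ)
  have hun : {t | 0 < F t} = ⋃ n, {t | u n ≤ F t} := by
    ext t
    simp only [Set.mem_ofPred_eq, Set.mem_iUnion]
    exact ⟨fun h => ((hut.eventually_lt_const h).exists).imp fun n hn => hn.le,
      fun ⟨n, hn⟩ => (hu n).trans_le hn⟩
  rw [hun, (Monotone.directed_le fun i j hij t (ht : u i ≤ F t) =>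
    (hua.antitone hij).trans ht : Directed (· ⊆ ·) fun n => {t | u n ≤ F t}).measure_iUnion,
    lt_iSup_iff] at hc
  obtain ⟨n, hn⟩ := hc
  set δ := u n with hδ
  have hδ0 : 0 < δ := hu n
  set A : Set Torus := {t | δ ≤ F t} with hA
  have mA : MeasurableSet A := measurableSet_le measurable_const hF
  have hAr : 1 / 2 < volume.real A := by
    have := (ENNReal.toReal_lt_toReal (by simp) (measure_ne_top _ _)).2 hn
    simpa [Measure.real] using this
  have hpt : ∀ t, |F t - δ| ≤ |F t| + (δ - A.indicator (fun _ => 2 * δ) t) := by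
    intro t
    by_cases ht : t ∈ A
    · have h1 : δ ≤ F t := ht
      rw [Set.indicator_of_mem ht, abs_of_nonneg (by linarith), abs_of_nonneg (by linarith)]
      linarith
    · rw [Set.indicator_of_notMem ht]
      have := abs_sub (F t) δ
      rw [abs_of_pos hδ0] at this
      linarith
  have i1 : Integrable (A.indicator fun _ => 2 * δ) (volume : Measure Torus) :=
    (integrable_const _).indicator mA
  have i2 : Integrable (fun t => δ - A.indicator (fun _ => 2 * δ) t) (volume : Measure Torus) :=
    (integrable_const δ).sub i1
  have h1 : ∫ t, |F t - δ| ≤ ∫ t, (|F t| + (δ - A.indicator (fun _ => 2 * δ) t)) :=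
    integral_mono (hFi.sub (integrable_const δ)).abs
      (hFi.abs.add i2) hpt
  rw [integral_add hFi.abs i2, integral_sub (integrable_const δ) i1,
    integral_indicator_const _ mA] at h1
  simp only [integral_const, probReal_univ, smul_eq_mul] at h1
  have := h δ
  nlinarith

lemma isMedian_zero_of_integral_le (hF : Measurable F) (hFi : Integrable F)
    (h : ∀ c : ℝ, ∫ t, |F t| ≤ ∫ t, |F t - c|) : IsMedian F 0 := by
  refine ⟨volume_lt_le_half_of_integral_le hF hFi h, ?_⟩
  have := volume_lt_le_half_of_integral_le (F := fun t => -F t) hF.neg hFi.neg fun c => by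
    simp only [abs_neg]
    refine (h (-c)).trans (le_of_eq ?_)
    congr 1; ext t
    rw [← abs_neg]; congr 1; ring
  simpa using this

end Median

/-! ### `W1` of real measures as an `L¹` distance modulo constants -/

/-- The constants `c` and `d` are free: `σ` has mass zero and `g` has mean zero. -/
lemma sintegral_eq_of_density {σ : SignedMeasure Torus} (h0 : σ Set.univ = 0) {g : Torus → ℝ}
    (hg : Measurable g) (hb : ∀ t, |g t| ≤ 1) (hi : ∫ t, g t = 0) (c d : ℝ) :
    sintegral σ (fun x => d + splineConv g x) = -∫ t, g t * (bernoulliConv σ t - c) := by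
  have hgi : Integrable g := integrable_of_abs_le hg.aestronglyMeasurable 1 hb
  have hgF : Integrable fun t => g t * bernoulliConv σ t :=
    (integrable_bernoulliConv σ).bdd_mul hg.aestronglyMeasurable (Filter.Eventually.of_forall hb)
  rw [sintegral_add σ (integrable_const d) (Lipschitz.integrable (lipschitzWith_splineConv hg hb hi) _),
    sintegral_const, h0, mul_zero, zero_add, sintegral_splineConv σ hg hb hi]
  simp only [mul_sub]
  rw [integral_sub hgF (hgi.mul_const c), integral_mul_const, hi, zero_mul, sub_zero]

/-- Testing a signed measure of mass zero against a `1`-Lipschitz function. -/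
lemma sintegral_le_integral_abs {σ : SignedMeasure Torus} (h0 : σ Set.univ = 0) {f : Torus → ℝ}
    (hf : LipschitzWith 1 f) (c : ℝ) : sintegral σ f ≤ ∫ t, |bernoulliConv σ t - c| := by
  obtain ⟨g, hg, hb, hi, hfg⟩ := exists_density_of_lipschitz hf
  rw [funext hfg, sintegral_eq_of_density h0 hg hb hi c, ← integral_neg]
  have hFi : Integrable fun t => bernoulliConv σ t - c :=
    (integrable_bernoulliConv σ).sub (integrable_const c)
  refine integral_mono (hFi.bdd_mul hg.aestronglyMeasurable
    (Filter.Eventually.of_forall hb)).neg hFi.abs fun t => ?_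
  calc -(g t * (bernoulliConv σ t - c)) ≤ |g t * (bernoulliConv σ t - c)| := neg_le_abs _
    _ ≤ 1 * |bernoulliConv σ t - c| := by
      rw [abs_mul]; exact mul_le_mul_of_nonneg_right (hb t) (abs_nonneg _)
    _ = _ := one_mul _

/-- The extremal function has derivative minus the corrected sign of the function minus its median;
the minus cancels the one produced by duality. -/
lemma exists_lipschitz_eq_of_isMedian {σ : SignedMeasure Torus} (h0 : σ Set.univ = 0) {m : ℝ}
    (hm : IsMedian (bernoulliConv σ) m) :
    ∃ f : Torus → ℝ, LipschitzWith 1 f ∧ sintegral σ f = ∫ t, |bernoulliConv σ t - m| := by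
  obtain ⟨g, hg, hb, hi, hgF⟩ := hm.exists_sign (measurable_bernoulliConv σ)
  have hi' : ∫ t, -g t = 0 := by rw [integral_neg, hi, neg_zero]
  have hb' : ∀ t, |-g t| ≤ 1 := fun t => by rw [abs_neg]; exact hb t
  refine ⟨splineConv fun t => -g t, lipschitzWith_splineConv hg.neg hb' hi', ?_⟩
  have := sintegral_eq_of_density h0 hg.neg hb' hi' m 0
  simp only [zero_add] at this
  refine this.trans ?_
  rw [← integral_neg]
  refine integral_congr_ae (Filter.Eventually.of_forall fun t => ?_)
  simp only [← hgF, Pi.neg_apply]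
  ring

lemma W1_eq_of_isMedian {ν μ : SignedMeasure Torus} (hν : ν Set.univ = 1) (hμ : μ Set.univ = 1)
    {m : ℝ} (hm : IsMedian (bernoulliConv (ν - μ)) m) :
    W1 (ofReal ν) (ofReal μ) = ENNReal.ofReal (∫ t, |bernoulliConv (ν - μ) t - m|) := by
  have h0 : (ν - μ) Set.univ = 0 := by simp [hν, hμ]
  refine le_antisymm (W1_ofReal_le ν μ fun f hf => sintegral_le_integral_abs h0 hf m) ?_
  obtain ⟨f, hf, hfe⟩ := exists_lipschitz_eq_of_isMedian h0 hm
  have := ofReal_le_W1 (ofReal ν) (ofReal μ) hf hf (a := 1) (b := 0) (by norm_num)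
  rw [← ofReal_sub, re_ofReal, one_mul, zero_mul, add_zero, hfe] at this
  exact this

lemma W1_le_integral_abs {ν μ : SignedMeasure Torus} (hν : ν Set.univ = 1) (hμ : μ Set.univ = 1)
    (c : ℝ) : W1 (ofReal ν) (ofReal μ) ≤ ENNReal.ofReal (∫ t, |bernoulliConv (ν - μ) t - c|) :=
  W1_ofReal_le ν μ fun _ hf => sintegral_le_integral_abs (by simp [hν, hμ]) hf c

lemma exists_W1_eq {ν μ : SignedMeasure Torus} (hν : ν Set.univ = 1) (hμ : μ Set.univ = 1) :
    ∃ c, W1 (ofReal ν) (ofReal μ) = ENNReal.ofReal (∫ t, |bernoulliConv (ν - μ) t - c|) := by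
  obtain ⟨C, hC⟩ := exists_abs_bernoulliConv_le (ν - μ)
  obtain ⟨m, hm⟩ := exists_isMedian (measurable_bernoulliConv (ν - μ)) hC
  exact ⟨m, W1_eq_of_isMedian hν hμ hm⟩

lemma eLpNorm_bernoulliConv_sub (ν μ : SignedMeasure Torus) (c : ℝ) :
    eLpNorm (fun t => bernoulliConv ν t - bernoulliConv μ t - c) 1 volume =
      ENNReal.ofReal (∫ t, |bernoulliConv (ν - μ) t - c|) := by
  have hFi : Integrable fun t => bernoulliConv (ν - μ) t - c :=
    (integrable_bernoulliConv _).sub (integrable_const c)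
  have e : (fun t => bernoulliConv ν t - bernoulliConv μ t - c) =
      fun t => bernoulliConv (ν - μ) t - c := by
    ext t; rw [bernoulliConv_sub]
  rw [e, eLpNorm_one_eq_lintegral_enorm, ← ofReal_integral_norm_eq_lintegral_enorm hFi]
  rfl

theorem wasserstein_eq_min_integral {ν μ : SignedMeasure Torus} (hν : ν Set.univ = 1)
    (hμ : μ Set.univ = 1) :
    MemLp (bernoulliConv ν - bernoulliConv μ) 1 volume ∧
      IsLeast
        (Set.range fun c : ℝ => eLpNorm
          (fun t => bernoulliConv ν t - bernoulliConv μ t - c) 1 volume)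
        (W1 (ofReal ν) (ofReal μ)) ∧
      (W1 (ofReal ν) (ofReal μ) = eLpNorm (bernoulliConv ν - bernoulliConv μ) 1 volume ↔
        volume {t | 0 < bernoulliConv ν t - bernoulliConv μ t} ≤ 1 / 2 ∧
        volume {t | bernoulliConv ν t - bernoulliConv μ t < 0} ≤ 1 / 2) := by
  refine ⟨memLp_one_iff_integrable.2
    ((integrable_bernoulliConv ν).sub (integrable_bernoulliConv μ)), ⟨?_, ?_⟩, ?_⟩
  · obtain ⟨c, hc⟩ := exists_W1_eq hν hμ
    exact ⟨c, by simp only [eLpNorm_bernoulliConv_sub, hc]⟩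
  · rintro _ ⟨c, rfl⟩
    simp only [eLpNorm_bernoulliConv_sub]
    exact W1_le_integral_abs hν hμ c
  · have e : eLpNorm (bernoulliConv ν - bernoulliConv μ) 1 volume =
        ENNReal.ofReal (∫ t, |bernoulliConv (ν - μ) t|) := by
      have := eLpNorm_bernoulliConv_sub ν μ 0
      simp only [sub_zero] at this
      exact this
    simp only [e, ← bernoulliConv_sub]
    change _ ↔ IsMedian (bernoulliConv (ν - μ)) 0
    constructor
    · intro h
      refine isMedian_zero_of_integral_le (measurable_bernoulliConv _)
        (integrable_bernoulliConv _) fun c => ?_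
      have := W1_le_integral_abs hν hμ c
      rw [h] at this
      exact (ENNReal.ofReal_le_ofReal_iff (integral_nonneg fun _ => abs_nonneg _)).1 this
    · intro h
      simpa only [sub_zero] using W1_eq_of_isMedian hν hμ h

/-! ### Sign changes and perturbation of the mean of `|φ|` -/

/-- A continuous function on `(0, b)`, `b ≤ 1`, whose zeros lie in a finite set `Z` changes sign
exactly at the points of some subset of `Z`. -/
lemma exists_sign_pattern (Z : Finset ℝ) (hZ : ∀ z ∈ Z, 0 < z) (ψ : ℝ → ℝ) :
    ∀ b ≤ (1 : ℝ), ContinuousOn ψ (Set.Ioo 0 b) → (∀ s ∈ Set.Ioo 0 b, ψ s = 0 → s ∈ Z) →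
      ∃ A ⊆ Z, ∃ ε : ℝ, (ε = 1 ∨ ε = -1) ∧
        ∀ s ∈ Set.Ioo 0 b, 0 ≤ ε * ψ s * ∏ z ∈ A, Real.sin (Real.pi * (s - z)) := by
  have const_sign : ∀ a b : ℝ, ContinuousOn ψ (Set.Ioo a b) → (∀ s ∈ Set.Ioo a b, ψ s ≠ 0) →
      ∃ ε : ℝ, (ε = 1 ∨ ε = -1) ∧ ∀ s ∈ Set.Ioo a b, 0 ≤ ε * ψ s := by
    intro a b hc hne
    by_cases h : ∀ s ∈ Set.Ioo a b, 0 ≤ ψ s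
    · exact ⟨1, Or.inl rfl, fun s hs => by simpa using h s hs⟩
    · push Not at h
      obtain ⟨s₀, hs₀, hlt⟩ := h
      refine ⟨-1, Or.inr rfl, fun s hs => ?_⟩
      by_contra hpos
      have hpos' : 0 < ψ s := by linarith
      obtain ⟨t, ht, ht0⟩ := isPreconnected_Ioo.intermediate_value hs₀ hs hc ⟨hlt.le, hpos'.le⟩
      exact hne t ht ht0
  induction Z using Finset.induction_on_max with
  | empty =>
    intro b _ hc hz
    obtain ⟨ε, hε, h⟩ := const_sign 0 b hc fun s hs h0 => by simpa using hz s hs h0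
    exact ⟨∅, le_rfl, ε, hε, fun s hs => by simpa using h s hs⟩
  -- Induction on the largest point `z`: the hypothesis covers `(0, z)`, and the sign is constant on
  -- `(z, b)`. The point `z` enters `A` exactly when the right-hand sign `ε'` differs from `ε`.
  | insert z Z hmax ih =>
    have hZ' : ∀ w ∈ Z, 0 < w := fun w hw => hZ w (Finset.mem_insert_of_mem hw)
    have hz0 : 0 < z := hZ z (Finset.mem_insert_self _ _)
    have hzZ : z ∉ Z := fun h => lt_irrefl _ (hmax z h)
    intro b hb hc hz
    rcases le_or_gt b z with hbz | hzb
    · obtain ⟨A, hA, ε, hε, h⟩ := ih hZ' b hb hc fun s hs h0 => by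
        rcases Finset.mem_insert.1 (hz s hs h0) with rfl | h
        · exact absurd hs.2 (not_lt.2 hbz)
        · exact h
      exact ⟨A, hA.trans (Finset.subset_insert _ _), ε, hε, h⟩
    · obtain ⟨A, hA, ε, hε, h⟩ := ih hZ' z (hzb.le.trans hb)
        (hc.mono (Set.Ioo_subset_Ioo_right hzb.le)) fun s hs h0 => by
          rcases Finset.mem_insert.1 (hz s ⟨hs.1, hs.2.trans hzb⟩ h0) with rfl | h
          · exact absurd hs.2 (lt_irrefl _)
          · exact h
      obtain ⟨ε', hε', h'⟩ := const_sign z b (hc.mono (Set.Ioo_subset_Ioo_left hz0.le))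
        fun s hs h0 => by
          rcases Finset.mem_insert.1 (hz s ⟨hz0.trans hs.1, hs.2⟩ h0) with rfl | h
          · exact lt_irrefl _ hs.1
          · exact absurd (hmax s h) (not_lt.2 hs.1.le)
      -- Since `b ≤ 1`, all differences have modulus below `1`, so each sine has the sign of `s -
      -- w`.
      have hsin : ∀ s w : ℝ, w < s → s - w < 1 → 0 < Real.sin (Real.pi * (s - w)) :=
        fun s w h1 h2 => Real.sin_pos_of_pos_of_lt_pi
          (mul_pos Real.pi_pos (sub_pos.2 h1)) (by nlinarith [Real.pi_pos])
      have hright : ∀ s ∈ Set.Ioo z b, 0 < ∏ w ∈ A, Real.sin (Real.pi * (s - w)) := fun s hs =>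
        Finset.prod_pos fun w hw => hsin s w ((hmax w (hA hw)).trans hs.1)
          (by linarith [hZ' w (hA hw), hs.2])
      have hzA : z ∉ A := fun h => hzZ (hA h)
      by_cases hεε : ε = ε'
      · refine ⟨A, hA.trans (Finset.subset_insert _ _), ε, hε, fun s hs => ?_⟩
        rcases lt_trichotomy s z with hsz | rfl | hsz
        · exact h s ⟨hs.1, hsz⟩
        · by_cases h0 : ψ s = 0
          · simp [h0]
          -- The point of `Z` need not be a zero of `ψ`; the inequality there is the limit from the
          -- right.
          · have hcl : s ∈ closure (Set.Ioo s b) := by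
              rw [closure_Ioo hzb.ne]; exact Set.left_mem_Icc.2 hzb.le
            have hcont : ContinuousWithinAt
                (fun t => ε * ψ t * ∏ w ∈ A, Real.sin (Real.pi * (t - w))) (Set.Ioo s b) s := by
              refine ContinuousWithinAt.mul (ContinuousWithinAt.mul continuousWithinAt_const
                ((hc s hs).mono (Set.Ioo_subset_Ioo_left hs.1.le))) ?_
              exact Continuous.continuousWithinAt (by fun_prop)
            have := hcont.mem_closure (t := Set.Ici 0) hcl fun t ht =>
              mul_nonneg (hεε ▸ h' t ht) (hright t ht).le
            rwa [isClosed_Ici.closure_eq] at this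
        · exact mul_nonneg (hεε ▸ h' s ⟨hsz, hs.2⟩) (hright s ⟨hsz, hs.2⟩).le
      · have hneg : ε = -ε' := by
          rcases hε with h1 | h1 <;> rcases hε' with h2 | h2 <;> rw [h1, h2] at hεε ⊢ <;>
            first | exact absurd rfl hεε | norm_num
        refine ⟨insert z A, Finset.insert_subset_insert _ hA, ε', hε', fun s hs => ?_⟩
        rw [Finset.prod_insert hzA]
        rcases lt_trichotomy s z with hsz | rfl | hsz
        · have h1 := h s ⟨hs.1, hsz⟩
          have h2 := hsin z s hsz (by linarith [hs.1])
          have h3 : Real.sin (Real.pi * (s - z)) = -Real.sin (Real.pi * (z - s)) := by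
            rw [← Real.sin_neg]; congr 1; ring
          rw [h3]
          rw [hneg] at h1
          nlinarith [mul_nonneg h2.le h1]
        · simp
        · have h1 := h' s ⟨hsz, hs.2⟩
          have h2 := hsin s z hsz (by linarith [hs.2])
          rw [mul_comm (Real.sin _), ← mul_assoc]
          exact mul_nonneg (mul_nonneg h1 (hright s ⟨hsz, hs.2⟩).le) h2.le

lemma continuous_integrable {f : Torus → ℝ} (hf : Continuous f) : Integrable f :=
  hf.integrable_of_hasCompactSupport (HasCompactSupport.of_compactSpace f)

lemma eq_zero_of_integral_nonpos {f : Torus → ℝ} (hf : Continuous f) (h0 : ∀ x, 0 ≤ f x)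
    (h : ∫ x, f x ≤ 0) : ∀ x, f x = 0 := by
  have h1 : f =ᵐ[volume] 0 := (integral_eq_zero_iff_of_nonneg h0 (continuous_integrable hf)).1
    (le_antisymm h (integral_nonneg h0))
  exact congrFun ((hf.ae_eq_iff_eq volume continuous_const).1 h1)

/-- If `φ v ≥ 0` almost everywhere, `v ≠ 0`, and `φ` vanishes on a null set only, then a small
multiple of `v` reduces the mean of `|φ|`. -/
lemma exists_integral_abs_sub_lt {φ v : Torus → ℝ} (hφ : Continuous φ) (hv : Continuous v)
    (hz : volume {x | φ x = 0} = 0) (hφv : ∀ᵐ x, 0 ≤ φ x * v x) (hv0 : ∃ x, v x ≠ 0) :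
    ∃ ε : ℝ, ∫ x, |φ x - ε * v x| < ∫ x, |φ x| := by
  by_contra hcon
  push Not at hcon
  set ε : ℕ → ℝ := fun k => 1 / ((k : ℝ) + 1) with hε
  have hεpos : ∀ k, 0 < ε k := fun k => by positivity
  -- Almost everywhere `φ ≠ 0`, and once `ε k * |v| < |φ|` the quotient equals `|v|` because `φ` and
  -- `v` have compatible signs. The quotients are dominated by `|v|`; if no `ε` helped, all their
  -- integrals would be nonpositive, hence so would `∫ |v|`.
  have hlim : Filter.Tendsto (fun k => ∫ x, (|φ x| - |φ x - ε k * v x|) / ε k) Filter.atTop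
      (nhds (∫ x, |v x|)) := by
    refine tendsto_integral_of_dominated_convergence (fun x => |v x|) (fun k => ?_)
      (continuous_integrable hv.abs) (fun k => ?_) ?_
    · exact (by fun_prop : Continuous fun x => (|φ x| - |φ x - ε k * v x|) / ε k).aestronglyMeasurable
    · refine Filter.Eventually.of_forall fun x => ?_
      rw [norm_div, Real.norm_eq_abs, Real.norm_eq_abs, abs_of_pos (hεpos k), div_le_iff₀ (hεpos k)]
      refine (abs_abs_sub_abs_le _ _).trans (le_of_eq ?_)
      rw [sub_sub_cancel, abs_mul, abs_of_pos (hεpos k), mul_comm]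
    · have hne : ∀ᵐ x : Torus, φ x ≠ 0 := by
        rw [ae_iff]; simpa using hz
      filter_upwards [hne, hφv] with x hx hxv
      have hε0 : Filter.Tendsto (fun k => ε k * |v x|) Filter.atTop (nhds 0) := by
        have := (tendsto_one_div_add_atTop_nhds_zero_nat (𝕜 := ℝ)).mul_const |v x|
        rwa [zero_mul] at this
      refine Filter.Tendsto.congr' ?_ tendsto_const_nhds
      filter_upwards [hε0.eventually_lt_const (abs_pos.2 hx)] with k hk
      rw [eq_div_iff (hεpos k).ne']
      have hεk := hεpos k
      rcases lt_or_gt_of_ne hx with hneg | hpos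
      · have hvn : v x ≤ 0 := by
          by_contra h; push Not at h; nlinarith
        rw [abs_of_nonpos hvn, abs_of_neg hneg] at hk
        rw [abs_of_nonpos hvn, abs_of_neg hneg, abs_of_nonpos (by linarith)]
        ring
      · have hvn : 0 ≤ v x := by
          by_contra h; push Not at h; nlinarith
        rw [abs_of_nonneg hvn, abs_of_pos hpos] at hk
        rw [abs_of_nonneg hvn, abs_of_pos hpos, abs_of_nonneg (by linarith)]
        ring
  have hle : ∫ x, |v x| ≤ 0 := by
    refine le_of_tendsto hlim (Filter.Eventually.of_forall fun k => ?_)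
    rw [integral_div, integral_sub (continuous_integrable hφ.abs)
      (continuous_integrable (by fun_prop))]
    exact div_nonpos_of_nonpos_of_nonneg (sub_nonpos.2 (hcon (ε k))) (hεpos k).le
  obtain ⟨x, hx⟩ := hv0
  exact hx (abs_eq_zero.1 (eq_zero_of_integral_nonpos hv.abs (fun _ => abs_nonneg _) hle x))

/-! ### Trigonometric polynomials and the spline as a Fourier multiplier -/

/-- The trigonometric polynomial with coefficients `a k`, `|k| ≤ n`. -/
def trigSum (n : ℕ) (a : ℤ → ℂ) : C(Torus, ℂ) :=
  ∑ k ∈ Finset.Icc (-(n : ℤ)) n, a k • fourier k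

lemma mem_trigPoly_iff {n : ℕ} {q : C(Torus, ℂ)} :
    q ∈ trigPoly n ↔ ∃ a, q = trigSum n a := by
  rw [trigPoly, ← Finset.coe_Icc, Submodule.mem_span_image_finset_iff_exists_fun']
  exact exists_congr fun a => eq_comm

lemma trigSum_apply (n : ℕ) (a : ℤ → ℂ) (x : Torus) :
    trigSum n a x = ∑ k ∈ Finset.Icc (-(n : ℤ)) n, a k * fourier k x := by
  simp only [trigSum, ContinuousMap.coe_sum, Finset.sum_apply, ContinuousMap.coe_smul,
    Pi.smul_apply, smul_eq_mul]

lemma fourier_mem_trigPoly {n : ℕ} {k : ℤ} (hk : k ∈ Set.Icc (-(n : ℤ)) n) :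
    (fourier k : C(Torus, ℂ)) ∈ trigPoly n :=
  Submodule.subset_span ⟨k, hk, rfl⟩

lemma one_mem_trigPoly (n : ℕ) : (1 : C(Torus, ℂ)) ∈ trigPoly n := by
  have h : (1 : C(Torus, ℂ)) = fourier 0 := by
    ext x; exact fourier_zero.symm
  rw [h]
  exact fourier_mem_trigPoly ⟨by simp, by simp⟩

/-- The real part of a continuous function, as a complex function. -/
def rePart (q : C(Torus, ℂ)) : C(Torus, ℂ) :=
  ⟨fun x => ((q x).re : ℂ), by fun_prop⟩

@[simp] lemma rePart_apply (q : C(Torus, ℂ)) (x : Torus) : rePart q x = ((q x).re : ℂ) := rfl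

lemma star_mem_trigPoly {n : ℕ} {q : C(Torus, ℂ)} (hq : q ∈ trigPoly n) : star q ∈ trigPoly n := by
  obtain ⟨a, rfl⟩ := mem_trigPoly_iff.1 hq
  rw [trigSum, star_sum]
  refine Submodule.sum_mem _ fun k hk => ?_
  rw [star_smul]
  refine Submodule.smul_mem _ _ ?_
  have : star (fourier k : C(Torus, ℂ)) = fourier (-k) := by
    ext x; rw [ContinuousMap.star_apply]; exact fourier_neg.symm
  rw [this]
  rw [Finset.mem_Icc] at hk
  exact fourier_mem_trigPoly ⟨by lia, by lia⟩

lemma rePart_mem_trigPoly {n : ℕ} {q : C(Torus, ℂ)} (hq : q ∈ trigPoly n) :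
    rePart q ∈ trigPoly n := by
  have : rePart q = (1 / 2 : ℂ) • (q + star q) := by
    ext x
    rw [ContinuousMap.smul_apply, ContinuousMap.add_apply, ContinuousMap.star_apply, rePart_apply,
      smul_eq_mul, Complex.star_def, Complex.add_conj]
    push_cast; ring
  rw [this]
  exact Submodule.smul_mem _ _ (Submodule.add_mem _ hq (star_mem_trigPoly hq))

lemma exists_lipschitz_fourier (k : ℤ) :
    ∃ K : NNReal, LipschitzWith K (fourier k : C(Torus, ℂ)) := by
  refine ⟨‖(2 * Real.pi * Complex.I * k : ℂ)‖₊, lipschitzWith_of_lift ?_⟩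
  have hd : ∀ s : ℝ, HasDerivAt (fun s : ℝ => (fourier k : C(Torus, ℂ)) s)
      (2 * Real.pi * Complex.I * k / (1 : ℝ) * fourier k (s : Torus)) s :=
    fun s => hasDerivAt_fourier 1 k s
  refine lipschitzWith_of_nnnorm_deriv_le (fun s => (hd s).differentiableAt) fun s => ?_
  rw [(hd s).deriv, nnnorm_mul, Complex.ofReal_one, div_one]
  refine mul_le_of_le_one_right zero_le (le_of_eq ?_)
  exact NNReal.eq (Circle.norm_coe _)

lemma exists_lipschitz_of_mem_trigPoly {n : ℕ} {q : C(Torus, ℂ)} (hq : q ∈ trigPoly n) :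
    ∃ K : NNReal, LipschitzWith K q := by
  induction hq using Submodule.span_induction with
  | mem q h => obtain ⟨k, -, rfl⟩ := h; exact exists_lipschitz_fourier k
  | zero => exact ⟨0, LipschitzWith.const 0⟩
  | add p q _ _ hp hq =>
    obtain ⟨K, hK⟩ := hp
    obtain ⟨L, hL⟩ := hq
    exact ⟨K + L, hK.add hL⟩
  | smul c q _ hq =>
    obtain ⟨K, hK⟩ := hq
    exact ⟨‖c‖₊ * K, (lipschitzWith_smul c).comp hK⟩

/-- For `k ≠ 0`, translation by half a wavelength preserves the integral and changes its sign. -/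
lemma integral_fourier (k : ℤ) :
    ∫ x : Torus, (fourier k x : ℂ) = if k = 0 then 1 else 0 := by
  split_ifs with h
  · subst h
    simp only [fourier_zero, integral_const, probReal_univ, one_smul]
  · have h1 := integral_add_right_eq_self (μ := (volume : Measure Torus))
      (fun x : Torus => (fourier k x : ℂ)) (((1 / 2 / k : ℝ)) : Torus)
    have h2 : ∀ x : Torus, (fourier k (x + ((1 / 2 / k : ℝ) : Torus)) : ℂ) = -fourier k x :=
      fun x => fourier_add_half_inv_index h one_pos x
    simp only [h2, integral_neg] at h1
    exact self_eq_neg.1 h1.symm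

lemma continuous_integrable_complex {f : Torus → ℂ} (hf : Continuous f) : Integrable f :=
  hf.integrable_of_hasCompactSupport (HasCompactSupport.of_compactSpace f)

lemma integral_trigSum_mul (n : ℕ) (a : ℤ → ℂ) {j : ℤ} (hj : j ∈ Finset.Icc (-(n : ℤ)) n) :
    ∫ x, trigSum n a x * fourier (-j) x = a j := by
  have h : ∀ x, trigSum n a x * fourier (-j) x =
      ∑ k ∈ Finset.Icc (-(n : ℤ)) n, a k * fourier (k - j) x := fun x => by
    rw [trigSum_apply, Finset.sum_mul]
    refine Finset.sum_congr rfl fun k _ => ?_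
    rw [sub_eq_add_neg, fourier_add, mul_assoc]
  simp only [h]
  rw [integral_finsetSum _ fun k _ => continuous_integrable_complex (by fun_prop)]
  simp only [integral_const_mul, integral_fourier, sub_eq_zero]
  simp [hj]

lemma volume_singleton (x : Torus) : volume ({x} : Set Torus) = 0 := by
  refine le_antisymm (ENNReal.le_of_forall_pos_le_add fun ε hε _ => ?_) zero_le
  calc volume ({x} : Set Torus) ≤ volume (Metric.closedBall x (ε / 2)) :=
        measure_mono (Set.singleton_subset_iff.2 (Metric.mem_closedBall_self (by positivity)))
    _ ≤ ENNReal.ofReal (2 * (ε / 2)) := by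
        rw [AddCircle.volume_closedBall]
        exact ENNReal.ofReal_le_ofReal (min_le_right _ _)
    _ = 0 + ε := by rw [mul_div_cancel₀ _ two_ne_zero, ENNReal.ofReal_coe_nnreal, zero_add]

/-- The Fourier coefficients of the Bernoulli spline. -/
def splineCoeff (k : ℤ) : ℂ := ∫ x, (bernoulliSpline x : ℂ) * fourier (-k) x

/-- Off the point `0` the spline is minus the periodised first Bernoulli polynomial. At `k = 0`
division by zero gives `0`, which is the correct mean. -/
lemma splineCoeff_eq (k : ℤ) : splineCoeff k = 1 / (2 * Real.pi * Complex.I * k) := by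
  have h := fourierCoeff_bernoulli_eq one_ne_zero k
  rw [fourierCoeff, AddCircle.integral_haarAddCircle, inv_one, one_smul] at h
  have hne : ∀ᵐ x : Torus, x ≠ 0 := by simp [ae_iff, volume_singleton]
  have e : splineCoeff k = -∫ x : Torus, (fourier (-k) x : ℂ) •
      ((fun r : ℝ => (r : ℂ)) ∘ periodizedBernoulli 1) x := by
    rw [splineCoeff, ← integral_neg]
    refine integral_congr_ae ?_
    filter_upwards [hne] with x hx
    obtain ⟨s, h0, h1, rfl⟩ := exists_rep x
    have h0' : 0 < s := lt_of_le_of_ne h0 fun h => hx (by rw [← h]; rfl)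
    rw [bernoulliSpline_coe h0' h1, Function.comp_apply, periodizedBernoulli,
      AddCircle.liftIco_coe_apply ⟨h0, by linarith⟩, bernoulliFun_one, smul_eq_mul]
    push_cast; ring
  rw [e]
  refine (congrArg Neg.neg h).trans ?_
  simp [neg_div]

lemma splineCoeff_zero : splineCoeff 0 = 0 := by simp [splineCoeff_eq]

lemma splineCoeff_ne_zero {k : ℤ} (hk : k ≠ 0) : splineCoeff k ≠ 0 := by
  rw [splineCoeff_eq]
  have : (k : ℂ) ≠ 0 := by exact_mod_cast hk
  simp [this]

/-- The convolution of the spline with a continuous complex function. -/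
def cconv (p : C(Torus, ℂ)) (t : Torus) : ℂ := ∫ x, (bernoulliSpline (t - x) : ℂ) * p x

lemma integrable_cconv (p : C(Torus, ℂ)) (t : Torus) :
    Integrable fun x => (bernoulliSpline (t - x) : ℂ) * p x := by
  refine (continuous_integrable_complex p.continuous).bdd_mul (c := 1 / 2)
    (Measurable.aestronglyMeasurable (by fun_prop)) (Filter.Eventually.of_forall fun x => ?_)
  rw [Complex.norm_real]
  exact abs_bernoulliSpline_le _

lemma cconv_fourier (k : ℤ) (t : Torus) : cconv (fourier k) t = splineCoeff k * fourier k t := by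
  have h := integral_sub_left_eq_self
    (fun x : Torus => (bernoulliSpline x : ℂ) * fourier k (t - x)) volume t
  simp only [sub_sub_cancel] at h
  rw [cconv, h, splineCoeff, ← integral_mul_const]
  refine integral_congr_ae (Filter.Eventually.of_forall fun x => ?_)
  simp only
  have : (fourier k (t - x) : ℂ) = fourier (-k) x * fourier k t := by
    rw [fourier_apply, fourier_apply, fourier_apply, smul_sub, sub_eq_neg_add, ← neg_smul,
      AddCircle.toCircle_add, Circle.coe_mul]
  rw [this]
  ring

lemma cconv_trigSum (n : ℕ) (a : ℤ → ℂ) (t : Torus) :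
    cconv (trigSum n a) t = trigSum n (fun k => splineCoeff k * a k) t := by
  have h : ∀ x, (bernoulliSpline (t - x) : ℂ) * trigSum n a x =
      ∑ k ∈ Finset.Icc (-(n : ℤ)) n, a k * ((bernoulliSpline (t - x) : ℂ) * fourier k x) :=
    fun x => by
      rw [trigSum_apply, Finset.mul_sum]
      exact Finset.sum_congr rfl fun k _ => by ring
  rw [cconv]
  simp only [h]
  rw [integral_finsetSum _ fun k _ => (integrable_cconv (fourier k) t).const_mul (a k), trigSum_apply]
  refine Finset.sum_congr rfl fun k _ => ?_
  rw [integral_const_mul]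
  have := cconv_fourier k t
  rw [cconv] at this
  rw [this]
  ring

lemma cconv_re (p : C(Torus, ℂ)) (t : Torus) :
    (cconv p t).re = ∫ x, bernoulliSpline (t - x) * (p x).re := by
  rw [cconv, ← RCLike.re_eq_complex_re, ← integral_re (integrable_cconv p t)]
  refine integral_congr_ae (Filter.Eventually.of_forall fun x => ?_)
  simp

/-- Divide the coefficients by those of the spline. At frequency `0` the inverse of zero is `0`, so
`q` has mean zero and only the constant `a 0` is lost. -/
lemma exists_cconv_eq {n : ℕ} {v : C(Torus, ℂ)} (hv : v ∈ trigPoly n) :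
    ∃ q ∈ trigPoly n, ∫ x, q x = 0 ∧ ∃ c : ℂ, ∀ t, cconv q t = v t - c := by
  obtain ⟨a, rfl⟩ := mem_trigPoly_iff.1 hv
  have h0 : (0 : ℤ) ∈ Finset.Icc (-(n : ℤ)) n := by simp
  refine ⟨trigSum n fun k => (splineCoeff k)⁻¹ * a k, mem_trigPoly_iff.2 ⟨_, rfl⟩, ?_, a 0,
    fun t => ?_⟩
  · have := integral_trigSum_mul n (fun k => (splineCoeff k)⁻¹ * a k) h0
    simpa only [neg_zero, fourier_zero, mul_one, splineCoeff_zero, inv_zero, zero_mul] using this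
  · rw [cconv_trigSum, trigSum_apply, trigSum_apply, ← Finset.add_sum_erase _ _ h0,
      ← Finset.add_sum_erase _ (fun k => a k * (fourier k t : ℂ)) h0]
    simp only [splineCoeff_zero, fourier_zero, zero_mul, mul_one]
    have : ∀ k ∈ (Finset.Icc (-(n : ℤ)) n).erase 0,
        splineCoeff k * ((splineCoeff k)⁻¹ * a k) * (fourier k t : ℂ) = a k * fourier k t := by
      intro k hk
      rw [mul_inv_cancel_left₀ (splineCoeff_ne_zero (Finset.ne_of_mem_erase hk))]
    rw [Finset.sum_congr rfl this]
    ring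

/-- The convolution determines every coefficient except that of frequency `0`, which is the mean. -/
lemma eq_zero_of_cconv_eq_const {n : ℕ} {d : C(Torus, ℂ)} (hd : d ∈ trigPoly n)
    (h0 : ∫ x, d x = 0) {c : ℂ} (hc : ∀ t, cconv d t = c) : d = 0 := by
  obtain ⟨a, rfl⟩ := mem_trigPoly_iff.1 hd
  have ha : ∀ k ∈ Finset.Icc (-(n : ℤ)) n, a k = 0 := by
    intro k hk
    rcases eq_or_ne k 0 with rfl | hk0
    · have := integral_trigSum_mul n a hk
      simp only [neg_zero, fourier_zero, mul_one] at this
      rw [← this, h0]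
    · have h1 := integral_trigSum_mul n (fun k => splineCoeff k * a k) hk
      simp only [← cconv_trigSum, hc, integral_const_mul, integral_fourier, neg_eq_zero, hk0,
        if_false, mul_zero] at h1
      exact (mul_eq_zero.1 h1.symm).resolve_left (splineCoeff_ne_zero hk0)
  ext x
  rw [trigSum_apply]
  exact Finset.sum_eq_zero fun k hk => by rw [ha k hk, zero_mul]

lemma cconv_trigPoly_mem {n : ℕ} {q : C(Torus, ℂ)} (hq : q ∈ trigPoly n) :
    ∃ r ∈ trigPoly n, ∀ t, cconv q t = r t := by
  obtain ⟨a, rfl⟩ := mem_trigPoly_iff.1 hq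
  exact ⟨_, mem_trigPoly_iff.2 ⟨_, rfl⟩, cconv_trigSum n a⟩

/-! ### Zeros and prescribed signs, via polynomials in `fourier 1` -/

lemma fourier_natCast (j : ℕ) (x : Torus) : (fourier (j : ℤ) x : ℂ) = fourier 1 x ^ j := by
  induction j with
  | zero => simp only [Nat.cast_zero, fourier_zero, pow_zero]
  | succ j ih => rw [Nat.cast_succ, fourier_add, ih, pow_succ]

lemma fourier_neg_mul (n : ℕ) (x : Torus) : (fourier (-(n : ℤ)) x : ℂ) * fourier (n : ℤ) x = 1 := by
  rw [← fourier_add, neg_add_cancel, fourier_zero]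

lemma mem_trigPoly_of_polynomial {n : ℕ} {q : C(Torus, ℂ)} (P : Polynomial ℂ)
    (hP : P.natDegree ≤ 2 * n) (h : ∀ x, q x = fourier (-(n : ℤ)) x * P.eval (fourier 1 x)) :
    q ∈ trigPoly n := by
  have : q = ∑ j ∈ Finset.range (2 * n + 1), P.coeff j • fourier ((j : ℤ) - n) := by
    ext x
    rw [h, Polynomial.eval_eq_sum_range' (Nat.lt_succ_of_le hP)]
    simp only [ContinuousMap.coe_sum, Finset.sum_apply, ContinuousMap.coe_smul, Pi.smul_apply,
      smul_eq_mul, Finset.mul_sum]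
    refine Finset.sum_congr rfl fun j _ => ?_
    rw [sub_eq_neg_add, fourier_add, fourier_natCast]
    ring
  rw [this]
  refine Submodule.sum_mem _ fun j hj => Submodule.smul_mem _ _ (fourier_mem_trigPoly ?_)
  rw [Finset.mem_range] at hj
  constructor <;> lia

lemma exists_polynomial {n : ℕ} {q : C(Torus, ℂ)} (hq : q ∈ trigPoly n) :
    ∃ P : Polynomial ℂ, P.natDegree ≤ 2 * n ∧
      ∀ x, q x = fourier (-(n : ℤ)) x * P.eval (fourier 1 x) := by
  obtain ⟨a, rfl⟩ := mem_trigPoly_iff.1 hq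
  refine ⟨∑ k ∈ Finset.Icc (-(n : ℤ)) n, Polynomial.C (a k) * Polynomial.X ^ (k + n).toNat, ?_, ?_⟩
  · refine Polynomial.natDegree_sum_le_of_forall_le _ _ fun k hk => ?_
    rw [Finset.mem_Icc] at hk
    exact (Polynomial.natDegree_C_mul_X_pow_le _ _).trans (by lia)
  · intro x
    rw [trigSum_apply, Polynomial.eval_finsetSum, Finset.mul_sum]
    refine Finset.sum_congr rfl fun k hk => ?_
    rw [Finset.mem_Icc] at hk
    rw [Polynomial.eval_C_mul, Polynomial.eval_pow, Polynomial.eval_X, ← fourier_natCast,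
      Int.toNat_of_nonneg (by lia), mul_left_comm, ← fourier_add]
    congr 3; ring

/-- A nonzero trigonometric polynomial of degree at most `n` has at most `2n` zeros. -/
lemma exists_finset_zeros {n : ℕ} {q : C(Torus, ℂ)} (hq : q ∈ trigPoly n) (h0 : q ≠ 0) :
    ∃ S : Finset Torus, S.card ≤ 2 * n ∧ ∀ x, q x = 0 → x ∈ S := by
  obtain ⟨P, hP, h⟩ := exists_polynomial hq
  have hP0 : P ≠ 0 := by
    rintro rfl
    exact h0 (by ext x; simp only [h, Polynomial.eval_zero, mul_zero, ContinuousMap.zero_apply])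
  have hinj : Function.Injective fun x : Torus => (fourier 1 x : ℂ) := fun x y hxy => by
    simp only [fourier_one] at hxy
    exact AddCircle.injective_toCircle one_ne_zero (Circle.coe_injective hxy)
  refine ⟨P.roots.toFinset.preimage _ hinj.injOn, ?_, fun x hx => ?_⟩
  · calc _ ≤ P.roots.toFinset.card := Finset.card_le_card_of_injOn
          (fun x : Torus => (fourier 1 x : ℂ)) (fun x hx => Finset.mem_preimage.1 hx) hinj.injOn
      _ ≤ P.roots.card := Multiset.toFinset_card_le _
      _ ≤ P.natDegree := P.card_roots'
      _ ≤ 2 * n := hP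
  · rw [Finset.mem_preimage, Multiset.mem_toFinset, Polynomial.mem_roots hP0, Polynomial.IsRoot.def]
    rw [h] at hx
    refine (mul_eq_zero.1 hx).resolve_left fun h2 => ?_
    have := fourier_neg_mul n x
    rw [h2, zero_mul] at this
    exact zero_ne_one this

/-- The product of `sin (π (s - z))` over an even number of points is a trigonometric polynomial. -/
lemma exists_trigPoly_prod_sin {n m : ℕ} (A : Finset ℝ) (hA : A.card = 2 * m) (hm : m ≤ n) :
    ∃ q ∈ trigPoly n, ∀ s : ℝ, q (s : Torus) = ((∏ z ∈ A, Real.sin (Real.pi * (s - z)) : ℝ) : ℂ) := by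
  -- With `w = e^{2πis}`, each factor is `sin (π (s - z)) = e^{-πis} * c z * (w - e^{2πiz})`. The
  -- `2m` prefactors give `w ^ (-m)`, and `X ^ (n - m)` adapts this to the fixed prefactor `w ^
  -- (-n)`.
  set c : ℝ → ℂ := fun z => Complex.exp (-(Real.pi * Complex.I * z)) / (2 * Complex.I) with hc
  set P : Polynomial ℂ := Polynomial.C (∏ z ∈ A, c z) *
    (∏ z ∈ A, (Polynomial.X - Polynomial.C (fourier 1 (z : Torus)))) * Polynomial.X ^ (n - m)
  have hdeg : P.natDegree ≤ 2 * n := by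
    refine (Polynomial.natDegree_mul_le).trans ?_
    refine (add_le_add ((Polynomial.natDegree_C_mul_le _ _)) (Polynomial.natDegree_X_pow_le _)).trans ?_
    rw [Polynomial.natDegree_finsetProd_X_sub_C_eq_card, hA]
    lia
  refine ⟨⟨fun x => fourier (-(n : ℤ)) x * P.eval (fourier 1 x), by fun_prop⟩,
    mem_trigPoly_of_polynomial P hdeg fun x => rfl, fun s => ?_⟩
  have hw : ∀ s : ℝ, (fourier 1 (s : Torus) : ℂ) = Complex.exp (Real.pi * Complex.I * s) ^ 2 := by
    intro s
    rw [fourier_coe_apply, ← Complex.exp_nat_mul]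
    congr 1; push_cast; ring
  have hfac : ∀ z : ℝ, ((Real.sin (Real.pi * (s - z)) : ℝ) : ℂ) =
      Complex.exp (-(Real.pi * Complex.I * s)) *
        (c z * ((fourier 1 (s : Torus) : ℂ) - fourier 1 (z : Torus))) := by
    intro z
    have e1 : Complex.exp (-((Real.pi : ℂ) * (s - z)) * Complex.I) =
        Complex.exp (-(Real.pi * Complex.I * s)) * Complex.exp (Real.pi * Complex.I * z) := by
      rw [← Complex.exp_add]; congr 1; ring
    have e2 : Complex.exp ((Real.pi : ℂ) * (s - z) * Complex.I) =
        Complex.exp (Real.pi * Complex.I * s) * Complex.exp (-(Real.pi * Complex.I * z)) := by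
      rw [← Complex.exp_add]; congr 1; ring
    push_cast
    rw [Complex.sin, e1, e2, hw, hw, hc]
    simp only
    have hs := Complex.exp_ne_zero (Real.pi * Complex.I * s)
    have hz := Complex.exp_ne_zero (Real.pi * Complex.I * z)
    rw [Complex.exp_neg, Complex.exp_neg]
    generalize Complex.exp (Real.pi * Complex.I * s) = S at *
    generalize Complex.exp (Real.pi * Complex.I * z) = Z at *
    have hI := Complex.I_ne_zero
    field_simp
    rw [Complex.I_sq]
    ring
  have hS : (fourier (-(n : ℤ)) (s : Torus) : ℂ) * fourier 1 (s : Torus) ^ (n - m) =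
      Complex.exp (-(Real.pi * Complex.I * s)) ^ (2 * m) := by
    rw [← fourier_natCast, ← fourier_add, fourier_coe_apply, ← Complex.exp_nat_mul]
    congr 1
    push_cast [Nat.cast_sub hm]
    ring
  push_cast
  change fourier (-(n : ℤ)) (s : Torus) * P.eval (fourier 1 (s : Torus)) = _
  have : (∏ z ∈ A, Complex.sin (Real.pi * (s - z))) =
      ∏ z ∈ A, Complex.exp (-(Real.pi * Complex.I * s)) *
        (c z * ((fourier 1 (s : Torus) : ℂ) - fourier 1 (z : Torus))) :=
    Finset.prod_congr rfl fun z _ => by rw [← hfac]; push_cast; rfl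
  rw [this, Finset.prod_mul_distrib, Finset.prod_mul_distrib, Finset.prod_const, hA, ← hS]
  simp only [P, Polynomial.eval_mul, Polynomial.eval_C, Polynomial.eval_prod, Polynomial.eval_sub,
    Polynomial.eval_X, Polynomial.eval_pow]
  ring

lemma sin_pi_mul_ne_zero {s z : ℝ} (hs : 0 < s) (hs1 : s < 1) (hz : 0 ≤ z) (hz1 : z < 1)
    (h : s ≠ z) : Real.sin (Real.pi * (s - z)) ≠ 0 := by
  rcases lt_or_gt_of_ne h with h | h
  · exact (Real.sin_neg_of_neg_of_neg_pi_lt (mul_neg_of_pos_of_neg Real.pi_pos (by linarith))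
      (by nlinarith [Real.pi_pos])).ne
  · exact (Real.sin_pos_of_pos_of_lt_pi (mul_pos Real.pi_pos (by linarith))
      (by nlinarith [Real.pi_pos])).ne'

/-- A continuous function whose zeros lie among at most `2n` points has the same sign as some
nonzero trigonometric polynomial of degree at most `n`. -/
lemma exists_trigPoly_same_sign {n : ℕ} {φ : Torus → ℝ} (hφ : Continuous φ) {S : Finset Torus}
    (hS : S.card ≤ 2 * n) (hz : ∀ x, φ x = 0 → x ∈ S) :
    ∃ q ∈ trigPoly n, (∀ᵐ x, 0 ≤ φ x * (q x).re) ∧ ∃ x, (q x).re ≠ 0 := by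
  classical
  set rep : Torus → ℝ := fun x => (AddCircle.equivIco 1 0 x : ℝ) with hrep
  have rep0 : ∀ x, 0 ≤ rep x := fun x => (AddCircle.equivIco 1 0 x).2.1
  have rep1 : ∀ x, rep x < 1 := fun x => by simpa using (AddCircle.equivIco 1 0 x).2.2
  -- The torus is cut at `0`; a zero there lies outside `(0, 1)` and does not affect the sign
  -- pattern.
  set Z : Finset ℝ := (S.image rep).erase 0 with hZ
  have hZ0 : ∀ z ∈ Z, 0 < z := fun z hz => by
    obtain ⟨hne, hz'⟩ := Finset.mem_erase.1 hz
    obtain ⟨x, -, rfl⟩ := Finset.mem_image.1 hz'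
    exact lt_of_le_of_ne (rep0 x) (Ne.symm hne)
  have hZ1 : ∀ z ∈ Z, z < 1 := fun z hz => by
    obtain ⟨x, -, rfl⟩ := Finset.mem_image.1 (Finset.mem_of_mem_erase hz)
    exact rep1 x
  have hZc : Z.card ≤ 2 * n :=
    (Finset.card_le_card (Finset.erase_subset _ _)).trans (Finset.card_image_le.trans hS)
  obtain ⟨A, hA, ε, hε, hsign⟩ := exists_sign_pattern Z hZ0 (fun s => φ (s : Torus)) 1 le_rfl
    (Continuous.continuousOn (by fun_prop)) fun s hs h0 => by
      refine Finset.mem_erase.2 ⟨hs.1.ne', Finset.mem_image.2 ⟨s, hz _ h0, ?_⟩⟩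
      simp only [hrep]
      rw [AddCircle.equivIco_coe_eq ⟨hs.1.le, by linarith [hs.2]⟩]
  obtain ⟨B, m, hBc, hm, hB0, hB1, hBs⟩ : ∃ (B : Finset ℝ) (m : ℕ), B.card = 2 * m ∧ m ≤ n ∧
      (∀ z ∈ B, 0 ≤ z) ∧ (∀ z ∈ B, z < 1) ∧
      ∀ s ∈ Set.Ioo (0 : ℝ) 1, 0 ≤ ε * φ (s : Torus) * ∏ z ∈ B, Real.sin (Real.pi * (s - z)) := by
    have hAc : A.card ≤ 2 * n := (Finset.card_le_card hA).trans hZc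
    rcases Nat.even_or_odd' A.card with ⟨m, hm | hm⟩
    · exact ⟨A, m, hm, by lia, fun z hz => (hZ0 z (hA hz)).le, fun z hz => hZ1 z (hA hz), hsign⟩
    -- An odd number of nodes is completed by the node `0`, whose sine is nonnegative on `(0, 1)`.
    -- Parity keeps the total at most `2n`.
    · have h0A : (0 : ℝ) ∉ A := fun h => lt_irrefl _ (hZ0 0 (hA h))
      refine ⟨insert 0 A, m + 1, ?_, by lia, ?_, ?_, fun s hs => ?_⟩
      · rw [Finset.card_insert_of_notMem h0A, hm]; ring
      · intro z hz
        rcases Finset.mem_insert.1 hz with rfl | hz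
        · exact le_rfl
        · exact (hZ0 z (hA hz)).le
      · intro z hz
        rcases Finset.mem_insert.1 hz with rfl | hz
        · exact one_pos
        · exact hZ1 z (hA hz)
      · rw [Finset.prod_insert h0A, mul_left_comm]
        refine mul_nonneg (Real.sin_nonneg_of_nonneg_of_le_pi ?_ ?_) (hsign s hs)
        · rw [sub_zero]; exact mul_nonneg Real.pi_pos.le hs.1.le
        · rw [sub_zero]; exact mul_le_of_le_one_right Real.pi_pos.le hs.2.le
  obtain ⟨q, hq, hqs⟩ := exists_trigPoly_prod_sin B hBc hm
  have hre : ∀ s : ℝ, (((ε : ℂ) • q) (s : Torus)).re =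
      ε * ∏ z ∈ B, Real.sin (Real.pi * (s - z)) := fun s => by
    rw [ContinuousMap.smul_apply, hqs, smul_eq_mul, ← Complex.ofReal_mul, Complex.ofReal_re]
  refine ⟨(ε : ℂ) • q, Submodule.smul_mem _ _ hq, ?_, ?_⟩
  · have hne : ∀ᵐ x : Torus, x ≠ 0 := by simp [ae_iff, volume_singleton]
    filter_upwards [hne] with x hx
    obtain ⟨s, h0, h1, rfl⟩ := exists_rep x
    have h0' : 0 < s := lt_of_le_of_ne h0 fun h => hx (by rw [← h]; rfl)
    rw [hre]
    calc (0 : ℝ) ≤ _ := hBs s ⟨h0', h1⟩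
      _ = _ := by ring
  · obtain ⟨s, hs, hsB⟩ := (Set.Ioo_infinite (zero_lt_one (α := ℝ))).exists_notMem_finset B
    refine ⟨s, ?_⟩
    rw [hre]
    refine mul_ne_zero (by rcases hε with h | h <;> rw [h] <;> norm_num)
      (Finset.prod_ne_zero_iff.2 fun z hz => ?_)
    exact sin_pi_mul_ne_zero hs.1 hs.2 (hB0 z hz) (hB1 z hz) fun h => hsB (h ▸ hz)

/-- **Jackson's theorem**: a continuous real function has at most one best approximation in the mean
by real trigonometric polynomials of degree at most `n`. -/
lemma best_mean_approx_unique {n : ℕ} {Φ : Torus → ℝ} (hΦ : Continuous Φ) {h₁ h₂ : C(Torus, ℂ)}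
    (m₁ : h₁ ∈ trigPoly n) (m₂ : h₂ ∈ trigPoly n) {E : ℝ}
    (hE : ∀ v ∈ trigPoly n, E ≤ ∫ x, |Φ x - (v x).re|)
    (e₁ : ∫ x, |Φ x - (h₁ x).re| ≤ E) (e₂ : ∫ x, |Φ x - (h₂ x).re| ≤ E) (x : Torus) :
    (h₁ x).re = (h₂ x).re := by
  set d := rePart (h₁ - h₂) with hd
  suffices d = 0 by
    have := congrArg Complex.re (DFunLike.congr_fun this x)
    simpa [hd, sub_eq_zero] using this
  by_contra hd0
  obtain ⟨S, hS, hSz⟩ := exists_finset_zeros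
    (rePart_mem_trigPoly (Submodule.sub_mem _ m₁ m₂)) hd0
  set h : C(Torus, ℂ) := (1 / 2 : ℂ) • (h₁ + h₂) with hh
  have hm : h ∈ trigPoly n := Submodule.smul_mem _ _ (Submodule.add_mem _ m₁ m₂)
  have hre : ∀ x, (h x).re = ((h₁ x).re + (h₂ x).re) / 2 := fun x => by
    rw [hh, ContinuousMap.smul_apply, ContinuousMap.add_apply, smul_eq_mul,
      show (1 / 2 : ℂ) = ((1 / 2 : ℝ) : ℂ) by push_cast; rfl, Complex.re_ofReal_mul, Complex.add_re]
    ring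
  set φ : Torus → ℝ := fun x => Φ x - (h x).re with hφ
  have hφc : Continuous φ := by fun_prop
  have c₁ : Continuous fun x => |Φ x - (h₁ x).re| := by fun_prop
  have c₂ : Continuous fun x => |Φ x - (h₂ x).re| := by fun_prop
  -- The midpoint `h` cannot beat `E`, so the triangle inequality is an equality in the mean, and by
  -- continuity at every point.
  have hpt : ∀ x, |Φ x - (h₁ x).re| + |Φ x - (h₂ x).re| - 2 * |φ x| = 0 := by
    refine eq_zero_of_integral_nonpos (by fun_prop) (fun x => ?_) ?_
    · have h2 : (2 : ℝ) * |φ x| = |(Φ x - (h₁ x).re) + (Φ x - (h₂ x).re)| := by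
        have h3 : |2 * φ x| = 2 * |φ x| := by rw [abs_mul, abs_two]
        rw [← h3]
        congr 1
        simp only [hφ, hre]; ring
      rw [h2]
      linarith [abs_add_le (Φ x - (h₁ x).re) (Φ x - (h₂ x).re)]
    · have c₃ : Continuous fun x => |Φ x - (h₁ x).re| + |Φ x - (h₂ x).re| := c₁.add c₂
      have c₄ : Continuous fun x => 2 * |φ x| := by fun_prop
      rw [integral_sub (continuous_integrable c₃) (continuous_integrable c₄), integral_add (continuous_integrable c₁)
        (continuous_integrable c₂), integral_const_mul]
      linarith [hE h hm]
  -- Where the midpoint has no error, neither do `h₁` and `h₂`, so their real parts agree there.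
  have hφz : ∀ x, φ x = 0 → x ∈ S := fun x hx => hSz x <| by
    have := hpt x
    rw [hx, abs_zero, mul_zero, sub_zero] at this
    have a1 := abs_nonneg (Φ x - (h₁ x).re)
    have a2 := abs_nonneg (Φ x - (h₂ x).re)
    have b1 := abs_eq_zero.1 (by linarith : |Φ x - (h₁ x).re| = 0)
    have b2 := abs_eq_zero.1 (by linarith : |Φ x - (h₂ x).re| = 0)
    rw [rePart_apply, ContinuousMap.sub_apply, Complex.sub_re]
    rw [show (h₁ x).re - (h₂ x).re = 0 by linarith, Complex.ofReal_zero]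
  obtain ⟨q, hq, hqφ, hq0⟩ := exists_trigPoly_same_sign hφc hS hφz
  have hnull : volume {x | φ x = 0} = 0 := by
    refine measure_mono_null (fun x hx => hφz x hx) ?_
    rw [← Set.biUnion_of_singleton (S : Set Torus)]
    exact (measure_biUnion_null_iff S.countable_toSet).2 fun x _ => volume_singleton x
  obtain ⟨ε, hε⟩ := exists_integral_abs_sub_lt hφc (v := fun x => (q x).re) (by fun_prop) hnull
    hqφ hq0
  have h1 := hE (h + (ε : ℂ) • q) (Submodule.add_mem _ hm (Submodule.smul_mem _ _ hq))
  have h2 : ∫ x, |Φ x - ((h + (ε : ℂ) • q) x).re| = ∫ x, |φ x - ε * (q x).re| := by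
    congr 1; ext x
    rw [ContinuousMap.add_apply, Complex.add_re, ContinuousMap.smul_apply (ε : ℂ) q, smul_eq_mul,
      Complex.re_ofReal_mul]
    congr 1
    simp only [hφ]; ring
  have h3 : 2 * ∫ x, |φ x| = (∫ x, |Φ x - (h₁ x).re|) + ∫ x, |Φ x - (h₂ x).re| := by
    rw [← integral_const_mul, ← integral_add (continuous_integrable c₁) (continuous_integrable c₂)]
    congr 1; ext x
    linarith [hpt x]
  linarith

/-! ### Measures with continuous density -/

/-- The signed measure whose density is the real part of `q`. -/
def reDensity (q : C(Torus, ℂ)) : SignedMeasure Torus :=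
  volume.withDensityᵥ fun x => (q x).re

lemma re_ofDensity (q : C(Torus, ℂ)) : ComplexMeasure.re (ofDensity q) = reDensity q := by
  have hq := continuous_integrable_complex q.continuous
  ext s hs
  change (ofDensity q s).re = _
  rw [ofDensity, reDensity, withDensityᵥ_apply hq hs]
  exact (integral_re hq.integrableOn).symm.trans (withDensityᵥ_apply hq.re hs).symm

lemma im_ofDensity (q : C(Torus, ℂ)) : ComplexMeasure.im (ofDensity q) =
    volume.withDensityᵥ fun x => (q x).im := by
  have hq := continuous_integrable_complex q.continuous
  ext s hs
  change (ofDensity q s).im = _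
  rw [ofDensity, withDensityᵥ_apply hq hs]
  exact (integral_im hq.integrableOn).symm.trans (withDensityᵥ_apply hq.im hs).symm

lemma ofDensity_rePart (q : C(Torus, ℂ)) : ofDensity (rePart q) = ofReal (reDensity q) := by
  have h1 : ComplexMeasure.re (ofDensity (rePart q)) = reDensity q := by
    rw [re_ofDensity]; rfl
  have h2 : ComplexMeasure.im (ofDensity (rePart q)) = 0 := by
    rw [im_ofDensity]
    simp only [rePart_apply, Complex.ofReal_im]
    exact withDensityᵥ_zero
  rw [← ComplexMeasure.toComplexMeasure_to_signedMeasure (ofDensity (rePart q)), h1, h2]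
  rfl

lemma reDensity_univ (q : C(Torus, ℂ)) : reDensity q Set.univ = (∫ x, q x).re := by
  have hq := continuous_integrable_complex q.continuous
  refine (withDensityᵥ_apply hq.re MeasurableSet.univ).trans ?_
  rw [setIntegral_univ]
  exact integral_re hq

lemma bernoulliConv_reDensity (q : C(Torus, ℂ)) (t : Torus) :
    bernoulliConv (reDensity q) t = (cconv q t).re := by
  rw [cconv_re, bernoulliConv_eq_sintegral]
  exact sintegral_withDensity (by fun_prop) (by fun_prop) (1 / 2) fun _ => abs_bernoulliSpline_le _

lemma cintegral_ofDensity (q : C(Torus, ℂ)) {f : Torus → ℂ} (hf : Continuous f) :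
    cintegral (ofDensity q) f = ∫ x, f x * q x := by
  obtain ⟨C, hC⟩ := isCompact_univ.exists_bound_of_continuousOn hf.continuousOn
  have hre : ∀ x, ‖(f x).re‖ ≤ C := fun x =>
    (Complex.abs_re_le_norm _).trans (hC x (Set.mem_univ x))
  have him : ∀ x, ‖(f x).im‖ ≤ C := fun x =>
    (Complex.abs_im_le_norm _).trans (hC x (Set.mem_univ x))
  have hi : Integrable (fun x => f x * q x) := continuous_integrable_complex (by fun_prop)
  have mre : Measurable fun x => (f x).re := (Complex.continuous_re.comp hf).measurable
  have mim : Measurable fun x => (f x).im := (Complex.continuous_im.comp hf).measurable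
  have cqr : Continuous fun x => (q x).re := by fun_prop
  have cqi : Continuous fun x => (q x).im := by fun_prop
  rw [cintegral_eq _ (hf.integrable_of_hasCompactSupport (HasCompactSupport.of_compactSpace f)),
    re_ofDensity, im_ofDensity, reDensity, sintegral_withDensity cqr mre C hre,
    sintegral_withDensity cqi mim C him, sintegral_withDensity cqr mim C him,
    sintegral_withDensity cqi mre C hre]
  apply Complex.ext
  · rw [← RCLike.re_eq_complex_re, ← integral_re hi,
      ← integral_sub (continuous_integrable (by fun_prop)) (continuous_integrable (by fun_prop))]
    refine integral_congr_ae (Filter.Eventually.of_forall fun x => ?_)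
    exact (Complex.mul_re _ _).symm
  · rw [← RCLike.im_eq_complex_im, ← integral_im hi,
      ← integral_add (continuous_integrable (by fun_prop)) (continuous_integrable (by fun_prop))]
    refine integral_congr_ae (Filter.Eventually.of_forall fun x => ?_)
    simp only [RCLike.im_eq_complex_im, Complex.mul_im]
    ring

lemma cintegral_sub_measure (ν μ : ComplexMeasure Torus) {f : Torus → ℂ} (hf : Continuous f) :
    cintegral (ν - μ) f = cintegral ν f - cintegral μ f :=
  VectorMeasure.integral_sub_vectorMeasure
    (hf.integrable_of_hasCompactSupport (HasCompactSupport.of_compactSpace f))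
    (hf.integrable_of_hasCompactSupport (HasCompactSupport.of_compactSpace f))

/-! ### Consequences of finiteness of `W1` -/

lemma enorm_cintegral_le_W1 (ν μ : ComplexMeasure Torus) {f : Torus → ℂ} (hf : LipschitzWith 1 f) :
    ‖cintegral (ν - μ) f‖ₑ ≤ W1 ν μ :=
  le_iSup₂ (f := fun (f : Torus → ℂ) (_ : LipschitzWith 1 f) => ‖cintegral (ν - μ) f‖ₑ) f hf

/-- Rescaling by `K + 1` instead of `K` covers `K = 0`. -/
lemma norm_cintegral_le {ν μ : ComplexMeasure Torus} (h : W1 ν μ ≠ ∞) {f : Torus → ℂ} {K : NNReal}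
    (hf : LipschitzWith K f) : ‖cintegral (ν - μ) f‖ ≤ (K + 1) * (W1 ν μ).toReal := by
  have hK : (0 : ℝ) < K + 1 := by positivity
  have hg : LipschitzWith 1 fun x => ((K : ℝ) + 1)⁻¹ • f x := by
    refine LipschitzWith.of_dist_le_mul fun x y => ?_
    rw [dist_smul₀, Real.norm_eq_abs, abs_of_pos (inv_pos.2 hK), inv_mul_le_iff₀ hK]
    refine (hf.dist_le_mul x y).trans ?_
    rw [NNReal.coe_one, one_mul]
    exact mul_le_mul_of_nonneg_right (by linarith) dist_nonneg
  have h1 := enorm_cintegral_le_W1 ν μ hg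
  have h2 : cintegral (ν - μ) (fun x => ((K : ℝ) + 1)⁻¹ • f x) =
      ((K : ℝ) + 1)⁻¹ • cintegral (ν - μ) f := VectorMeasure.integral_fun_smul _ _ _ _
  rw [h2] at h1
  have h3 := ENNReal.toReal_mono h h1
  rw [toReal_enorm, norm_smul, Real.norm_eq_abs, abs_of_pos (inv_pos.2 hK), inv_mul_le_iff₀ hK] at h3
  exact h3

lemma cintegral_const (κ : ComplexMeasure Torus) (c : ℂ) :
    cintegral κ (fun _ => c) = c * κ Set.univ := by
  rw [cintegral, VectorMeasure.integral_const]
  rfl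

/-- Arbitrarily large constants are admissible test functions, so a mass difference would make `W1`
infinite. -/
lemma apply_univ_eq_of_W1_ne_top {ν μ : ComplexMeasure Torus} (h : W1 ν μ ≠ ∞) :
    ν Set.univ = μ Set.univ := by
  by_contra hne
  set z := (ν - μ) Set.univ with hz
  have hz0 : 0 < ‖z‖ := norm_pos_iff.2 (by simpa [hz, sub_eq_zero] using hne)
  obtain ⟨N, hN⟩ := exists_nat_gt ((W1 ν μ).toReal / ‖z‖)
  rw [div_lt_iff₀ hz0] at hN
  have h1 := norm_cintegral_le h (LipschitzWith.const (α := Torus) (N : ℂ))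
  rw [cintegral_const, norm_mul, Complex.norm_natCast] at h1
  simp only [NNReal.coe_zero, zero_add, one_mul] at h1
  exact absurd h1 (not_le.2 hN)

lemma ofReal_univ {μ : SignedMeasure Torus} (hμ : μ Set.univ = 1) : ofReal μ Set.univ = 1 := by
  change (⟨μ Set.univ, 0⟩ : ℂ) = 1
  rw [hμ]; rfl

lemma integral_eq_one_of_W1_ne_top {μ : SignedMeasure Torus} (hμ : μ Set.univ = 1)
    {q : C(Torus, ℂ)} (h : W1 (ofDensity q) (ofReal μ) ≠ ∞) : ∫ x, q x = 1 := by
  have := apply_univ_eq_of_W1_ne_top h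
  rw [ofReal_univ hμ, ofDensity, withDensityᵥ_apply
    (continuous_integrable_complex q.continuous) MeasurableSet.univ, setIntegral_univ] at this
  exact this

lemma rePart_eq_self {q : C(Torus, ℂ)} (hq : ∀ x, (q x).im = 0) : rePart q = q := by
  ext x
  rw [rePart_apply]
  exact Complex.ext (Complex.ofReal_re _) (by rw [Complex.ofReal_im, hq])

/-- The constant density is a competitor at finite distance, so every best approximation has finite
distance and therefore mass `1`. -/
lemma W1_one_ne_top {μ : SignedMeasure Torus} (hμ : μ Set.univ = 1) :
    W1 (ofDensity 1) (ofReal μ) ≠ ∞ := by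
  have h1 : rePart 1 = 1 := rePart_eq_self fun x => by simp
  have h2 : reDensity 1 Set.univ = 1 := by simp [reDensity_univ]
  rw [← h1, ofDensity_rePart]
  exact ne_top_of_le_ne_top ENNReal.ofReal_ne_top (W1_le_integral_abs h2 hμ 0)

/-! ### Existence of a best approximation -/

section Existence

instance finiteDimensional_trigPoly (n : ℕ) : FiniteDimensional ℂ (trigPoly n) :=
  FiniteDimensional.span_of_finite ℂ ((Set.finite_Icc _ _).image _)

lemma norm_le_sum_coeff {n : ℕ} {q : C(Torus, ℂ)} (hq : q ∈ trigPoly n) :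
    ‖q‖ ≤ ∑ k ∈ Finset.Icc (-(n : ℤ)) n, ‖∫ x, q x * fourier (-k) x‖ := by
  obtain ⟨a, rfl⟩ := mem_trigPoly_iff.1 hq
  rw [Finset.sum_congr rfl fun k hk => congrArg norm (integral_trigSum_mul n a hk), trigSum]
  refine (norm_sum_le _ _).trans (le_of_eq (Finset.sum_congr rfl fun k _ => ?_))
  rw [norm_smul, fourier_norm, mul_one]

lemma continuous_cintegral_ofDensity {n : ℕ} (μ : ComplexMeasure Torus) {f : Torus → ℂ}
    (hf : Continuous f) :
    Continuous fun q : trigPoly n => cintegral (ofDensity (q : C(Torus, ℂ)) - μ) f := by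
  have h : ∀ q : trigPoly n, cintegral (ofDensity (q : C(Torus, ℂ)) - μ) f =
      (∫ x, f x * (q : C(Torus, ℂ)) x) - cintegral μ f := fun q => by
    rw [cintegral_sub_measure _ _ hf, cintegral_ofDensity _ hf]
  simp only [h]
  let L : trigPoly n →ₗ[ℂ] ℂ :=
    { toFun := fun q => ∫ x, f x * (q : C(Torus, ℂ)) x
      map_add' := fun p q => by
        rw [← integral_add (continuous_integrable_complex (by fun_prop))
          (continuous_integrable_complex (by fun_prop))]
        simp only [Submodule.coe_add, ContinuousMap.add_apply, mul_add]
      map_smul' := fun c q => by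
        rw [RingHom.id_apply, smul_eq_mul, ← integral_const_mul]
        simp only [Submodule.coe_smul, ContinuousMap.smul_apply, smul_eq_mul, mul_left_comm] }
  exact (LinearMap.continuous_of_finiteDimensional (𝕜 := ℂ) (E := trigPoly n) (F' := ℂ) L).sub continuous_const

/-- A supremum of functions continuous on the finite-dimensional space `trigPoly n`. -/
lemma lowerSemicontinuous_W1 (n : ℕ) (μ : ComplexMeasure Torus) :
    LowerSemicontinuous fun q : trigPoly n => W1 (ofDensity (q : C(Torus, ℂ))) μ :=
  lowerSemicontinuous_iSup fun _ => lowerSemicontinuous_iSup fun hf =>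
    (continuous_cintegral_ofDensity μ hf.continuous).enorm.lowerSemicontinuous

/-- The sublevel set through the competitor `1` is closed by lower semicontinuity. It is bounded
because characters are Lipschitz, so `W1` bounds each Fourier coefficient. A minimum is therefore
attained there. -/
lemma exists_isBestApprox (n : ℕ) {μ : SignedMeasure Torus} (hμ : μ Set.univ = 1) :
    ∃ p, IsBestApprox n (ofReal μ) p := by
  have htop := W1_one_ne_top hμ
  set M := W1 (ofDensity 1) (ofReal μ) with hM
  set S : Set (trigPoly n) := {q | W1 (ofDensity (q : C(Torus, ℂ))) (ofReal μ) ≤ M} with hS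
  have hclosed : IsClosed S := (lowerSemicontinuous_W1 n (ofReal μ)).isClosed_preimage M
  choose K hK using exists_lipschitz_fourier
  have hbdd : Bornology.IsBounded S := by
    refine (isBounded_iff_forall_norm_le (E := trigPoly n)).2 ⟨∑ k ∈ Finset.Icc (-(n : ℤ)) n,
      ((K (-k) + 1) * M.toReal + ‖cintegral (ofReal μ) (fourier (-k))‖), fun q hq => ?_⟩
    refine (norm_le_sum_coeff q.2).trans (Finset.sum_le_sum fun k _ => ?_)
    have hqM : W1 (ofDensity (q : C(Torus, ℂ))) (ofReal μ) ≤ M := hq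
    have h1 := norm_cintegral_le (ne_top_of_le_ne_top htop hqM) (hK (-k))
    rw [cintegral_sub_measure _ _ (ContinuousMap.continuous _),
      cintegral_ofDensity _ (ContinuousMap.continuous _)] at h1
    have h2 : ∫ x, (q : C(Torus, ℂ)) x * fourier (-k) x =
        ((∫ x, fourier (-k) x * (q : C(Torus, ℂ)) x) - cintegral (ofReal μ) (fourier (-k)))
          + cintegral (ofReal μ) (fourier (-k)) := by
      rw [sub_add_cancel]
      congr 1; ext x; ring
    rw [h2]
    refine (norm_add_le _ _).trans (add_le_add (h1.trans ?_) le_rfl)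
    exact mul_le_mul_of_nonneg_left (ENNReal.toReal_mono htop hqM) (by positivity)
  have : ProperSpace (trigPoly n) := FiniteDimensional.proper ℂ (trigPoly n)
  have hcomp : IsCompact S := Metric.isCompact_of_isClosed_isBounded hclosed hbdd
  have h1S : (⟨1, one_mem_trigPoly n⟩ : trigPoly n) ∈ S := le_of_eq hM.symm
  obtain ⟨p, hpS, hp⟩ := ((lowerSemicontinuous_W1 n (ofReal μ)).lowerSemicontinuousOn S).exists_isMinOn
    ⟨_, h1S⟩ hcomp
  have hmin := isMinOn_iff.1 hp
  clear_value S M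
  refine ⟨p, p.2, fun q hq => ?_⟩
  by_cases hqS : W1 (ofDensity q) (ofReal μ) ≤ M
  · exact hmin ⟨q, hq⟩ (hS ▸ hqS)
  · exact le_trans (show _ ≤ M by rw [hS] at hpS; exact hpS) (le_of_lt (not_le.1 hqS))

end Existence

/-! ### Best approximations are real-valued -/

section Real

/-- A multiple of the imaginary part tests itself, giving `B > 0` unless it vanishes. Then `a * A +
b * B ≤ M` on the unit disc, where `A` is any test of the real part against `μ`. For small `b > 0`
the gain `b * B` is of first order and the loss in `a` of second order, so `A` stays below a bound
smaller than `M`, and the real part of `p` beats `p`. -/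
lemma im_eq_zero_of_isBestApprox {n : ℕ} {μ : SignedMeasure Torus} (hμ : μ Set.univ = 1)
    {p : C(Torus, ℂ)} (hp : IsBestApprox n (ofReal μ) p) (x : Torus) : (p x).im = 0 := by
  have htop : W1 (ofDensity p) (ofReal μ) ≠ ∞ :=
    ne_top_of_le_ne_top (W1_one_ne_top hμ) (hp.2 1 (one_mem_trigPoly n))
  set M := (W1 (ofDensity p) (ofReal μ)).toReal with hM
  have hM0 : 0 ≤ M := ENNReal.toReal_nonneg
  obtain ⟨K, hK⟩ := exists_lipschitz_of_mem_trigPoly hp.1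
  set f₁ : Torus → ℝ := fun x => ((K : ℝ) + 1)⁻¹ * (p x).im with hf₁
  have hKpos : (0 : ℝ) < K + 1 := by positivity
  have hL₁ : LipschitzWith 1 f₁ := by
    refine LipschitzWith.of_dist_le_mul fun x y => ?_
    rw [Real.dist_eq, ← mul_sub, abs_mul, abs_of_pos (inv_pos.2 hKpos), inv_mul_le_iff₀ hKpos,
      ← Complex.sub_im]
    refine (Complex.abs_im_le_norm _).trans ?_
    rw [← dist_eq_norm]
    refine (hK.dist_le_mul x y).trans ?_
    rw [NNReal.coe_one, one_mul]
    exact mul_le_mul_of_nonneg_right (by linarith) dist_nonneg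
  have hc : Continuous fun x => (p x).im := by fun_prop
  set B : ℝ := ∫ x, f₁ x * (p x).im with hB
  have hkey : ∀ f : Torus → ℝ, LipschitzWith 1 f → ∀ a b : ℝ, a ^ 2 + b ^ 2 ≤ 1 →
      a * sintegral (reDensity p - μ) f + b * B ≤ M := by
    intro f hf a b hab
    have h1 := ofReal_le_W1 (ofDensity p) (ofReal μ) hf hL₁ hab
    obtain ⟨C, hC⟩ := isCompact_univ.exists_bound_of_continuousOn hL₁.continuous.continuousOn
    rw [map_sub, map_sub, re_ofDensity, im_ofDensity, re_ofReal, im_ofReal, sub_zero,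
      sintegral_withDensity hc hL₁.continuous.measurable C fun x => hC x (Set.mem_univ x)] at h1
    exact (ENNReal.ofReal_le_iff_le_toReal htop).1 h1
  have hBle : B ≤ 0 := by
    by_contra hBpos
    push Not at hBpos
    have hMpos : 0 < M := by
      have := hkey (fun _ => 0) (LipschitzWith.const' 0) 0 1 (by norm_num)
      linarith
    -- Parameter of the rational point `((1 - s²)/(1 + s²), 2s/(1 + s²))` of the circle. The
    -- improved bound is below `M` as soon as `s * M < B`, and this `s` satisfies both that and `s <
    -- 1`.
    set s : ℝ := B / (2 * M + B) with hs
    have hden : 0 < 2 * M + B := by linarith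
    have hs0 : 0 < s := div_pos hBpos hden
    have hs1 : s < 1 := by rw [hs, div_lt_one hden]; linarith
    have hsM : s * (2 * M + B) = B := div_mul_cancel₀ _ hden.ne'
    have h1s : 0 < 1 + s ^ 2 := by positivity
    have ha : 0 < 1 - s ^ 2 := by nlinarith
    have hW : W1 (ofDensity (rePart p)) (ofReal μ) ≤
        ENNReal.ofReal (((1 + s ^ 2) * M - 2 * s * B) / (1 - s ^ 2)) := by
      rw [ofDensity_rePart]
      refine W1_ofReal_le _ _ fun f hf => ?_
      have h2 := hkey f hf ((1 - s ^ 2) / (1 + s ^ 2)) (2 * s / (1 + s ^ 2)) (by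
        rw [div_pow (1 - s ^ 2), div_pow (2 * s), ← add_div, div_le_one (by positivity)]
        linarith [sq_nonneg s])
      rw [le_div_iff₀ ha]
      rw [div_mul_eq_mul_div, div_mul_eq_mul_div, ← add_div, div_le_iff₀ h1s] at h2
      linarith
    have h3 := (hp.2 _ (rePart_mem_trigPoly hp.1)).trans hW
    have h4 := ENNReal.toReal_mono ENNReal.ofReal_ne_top h3
    rw [← hM, ENNReal.toReal_ofReal'] at h4
    have h5 : M ≤ ((1 + s ^ 2) * M - 2 * s * B) / (1 - s ^ 2) := by
      rcases le_max_iff.1 h4 with h | h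
      · exact h
      · linarith
    rw [le_div_iff₀ ha] at h5
    nlinarith [mul_pos hs0 hBpos, mul_pos hs0 hMpos]
  have hz := eq_zero_of_integral_nonpos (f := fun x => f₁ x * (p x).im) (by fun_prop)
    (fun x => by
      simp only [hf₁]
      rw [mul_assoc]
      exact mul_nonneg (inv_pos.2 hKpos).le (mul_self_nonneg _)) hBle x
  simp only [hf₁, mul_assoc, mul_eq_zero, or_self] at hz
  exact hz.resolve_left (inv_pos.2 hKpos).ne'

end Real

/-! ### Uniqueness of the best approximation -/

/-- Absolute continuity enters through the absence of atoms: for fixed `t` the jump at `x = t` is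
null for the variation, and dominated convergence applies. -/
lemma continuous_bernoulliConv {μ : SignedMeasure Torus}
    (hμ : VectorMeasure.AbsolutelyContinuous μ
      (volume : Measure Torus).toENNRealVectorMeasure) : Continuous (bernoulliConv μ) := by
  have hnull : ∀ t : Torus, μ.variation {t} = 0 := fun t => by
    refine (VectorMeasure.variation_apply_eq_zero (measurableSet_singleton t)).2 fun s hs hsm => ?_
    refine hμ ?_
    rw [Measure.toENNRealVectorMeasure_apply_measurable hsm]
    exact measure_mono_null hs (volume_singleton t)
  refine continuous_iff_continuousAt.2 fun t => ?_
  refine VectorMeasure.continuousAt_of_dominated (bound := fun _ => 1 / 2)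
    (Filter.Eventually.of_forall fun s => Measurable.aestronglyMeasurable (by fun_prop))
    (Filter.Eventually.of_forall fun s => Filter.Eventually.of_forall fun x =>
      abs_bernoulliSpline_le _) (integrable_const _) ?_
  have hne : ∀ᵐ x ∂μ.variation, x ≠ t := by
    rw [ae_iff]; simpa using hnull t
  filter_upwards [hne] with x hx
  exact ContinuousAt.comp (f := fun s => s - x)
    (continuousAt_bernoulliSpline (sub_ne_zero.2 (Ne.symm hx))) (by fun_prop)

lemma cconv_add (p q : C(Torus, ℂ)) (t : Torus) : cconv (p + q) t = cconv p t + cconv q t := by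
  rw [cconv, cconv, cconv, ← integral_add (integrable_cconv p t) (integrable_cconv q t)]
  simp only [ContinuousMap.add_apply, mul_add]

lemma cconv_sub (p q : C(Torus, ℂ)) (t : Torus) : cconv (p - q) t = cconv p t - cconv q t := by
  rw [cconv, cconv, cconv, ← integral_sub (integrable_cconv p t) (integrable_cconv q t)]
  simp only [ContinuousMap.sub_apply, mul_sub]

lemma cconv_one (t : Torus) : cconv 1 t = 0 := by
  have h : (1 : C(Torus, ℂ)) = fourier 0 := by
    ext x; exact fourier_zero.symm
  rw [h, cconv_fourier, splineCoeff_zero, zero_mul]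

lemma cconv_im_eq_zero {q : C(Torus, ℂ)} (hq : ∀ x, (q x).im = 0) (t : Torus) :
    (cconv q t).im = 0 := by
  rw [cconv, ← RCLike.im_eq_complex_im, ← integral_im (integrable_cconv q t)]
  simp [hq]

/-- Up to a constant, `v` is the convolution of a competitor `1 + q` of mass `1`, so the minimal
`W1` is a lower bound for `L¹` approximation by all of `trigPoly n`. -/
lemma W1_reDensity_le {n : ℕ} {μ : SignedMeasure Torus} (hμ : μ Set.univ = 1)
    {p v : C(Torus, ℂ)} (hp : IsBestApprox n (ofReal μ) p) (hv : v ∈ trigPoly n) :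
    W1 (ofDensity p) (ofReal μ) ≤ ENNReal.ofReal (∫ x, |bernoulliConv μ x - (v x).re|) := by
  obtain ⟨q, hq, hq0, c, hc⟩ := exists_cconv_eq hv
  have h1 : reDensity (1 + q) Set.univ = 1 := by
    rw [reDensity_univ]
    simp only [ContinuousMap.add_apply, ContinuousMap.one_apply]
    rw [integral_add (integrable_const _) (continuous_integrable_complex q.continuous), hq0]
    simp
  refine (hp.2 _ (rePart_mem_trigPoly (Submodule.add_mem _ (one_mem_trigPoly n) hq))).trans ?_
  rw [ofDensity_rePart]
  refine (W1_le_integral_abs h1 hμ (-c.re)).trans (le_of_eq ?_)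
  congr 2; ext t
  rw [bernoulliConv_sub, bernoulliConv_reDensity, cconv_add, cconv_one, zero_add, hc,
    Complex.sub_re, ← abs_neg]
  congr 1; ring

/-- Each minimiser, convolved and shifted by its optimal constant, is a best `L¹` approximation of
`bernoulliConv μ`. By Jackson's theorem these coincide, so the convolution of `p₁ - p₂` is constant;
having mean zero, the difference vanishes. -/
lemma isBestApprox_unique {n : ℕ} {μ : SignedMeasure Torus} (hμ : μ Set.univ = 1)
    (hac : VectorMeasure.AbsolutelyContinuous μ (volume : Measure Torus).toENNRealVectorMeasure)
    {p₁ p₂ : C(Torus, ℂ)} (h₁ : IsBestApprox n (ofReal μ) p₁)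
    (h₂ : IsBestApprox n (ofReal μ) p₂) : p₁ = p₂ := by
  have key : ∀ p, IsBestApprox n (ofReal μ) p → ∫ x, p x = 1 ∧ ∃ c : ℝ, ∃ h ∈ trigPoly n,
      (∀ t, (h t).re = (cconv p t).re - c) ∧
      ∫ x, |bernoulliConv μ x - (h x).re| = (W1 (ofDensity p) (ofReal μ)).toReal := by
    intro p hp
    have htop : W1 (ofDensity p) (ofReal μ) ≠ ∞ :=
      ne_top_of_le_ne_top (W1_one_ne_top hμ) (hp.2 1 (one_mem_trigPoly n))
    have hint := integral_eq_one_of_W1_ne_top hμ htop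
    have hd : reDensity p Set.univ = 1 := by rw [reDensity_univ, hint, Complex.one_re]
    obtain ⟨c, hc⟩ := exists_W1_eq hd hμ
    rw [← ofDensity_rePart, rePart_eq_self (im_eq_zero_of_isBestApprox hμ hp)] at hc
    obtain ⟨r, hr, hpr⟩ := cconv_trigPoly_mem hp.1
    have hre : ∀ t, ((r - (c : ℂ) • (1 : C(Torus, ℂ))) t).re = (cconv p t).re - c := fun t => by
      simp [hpr]
    refine ⟨hint, c, r - (c : ℂ) • 1,
      Submodule.sub_mem _ hr (Submodule.smul_mem _ _ (one_mem_trigPoly n)), hre, ?_⟩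
    rw [hc, ENNReal.toReal_ofReal (integral_nonneg fun _ => abs_nonneg _)]
    congr 1; ext t
    rw [hre, bernoulliConv_sub, bernoulliConv_reDensity, ← abs_neg]
    congr 1; ring
  obtain ⟨i₁, c₁, g₁, m₁, r₁, e₁⟩ := key p₁ h₁
  obtain ⟨i₂, c₂, g₂, m₂, r₂, e₂⟩ := key p₂ h₂
  have hW : W1 (ofDensity p₂) (ofReal μ) = W1 (ofDensity p₁) (ofReal μ) :=
    le_antisymm (h₂.2 _ h₁.1) (h₁.2 _ h₂.1)
  rw [hW] at e₂
  have hJ := best_mean_approx_unique (continuous_bernoulliConv hac) m₁ m₂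
    (E := (W1 (ofDensity p₁) (ofReal μ)).toReal) (fun v hv =>
      ENNReal.toReal_le_of_le_ofReal (integral_nonneg fun _ => abs_nonneg _)
        (W1_reDensity_le hμ h₁ hv)) e₁.le e₂.le
  have hd : p₁ - p₂ = 0 := by
    refine eq_zero_of_cconv_eq_const (Submodule.sub_mem _ h₁.1 h₂.1) ?_
      (c := ((c₁ - c₂ : ℝ) : ℂ)) fun t => ?_
    · simp only [ContinuousMap.sub_apply]
      rw [integral_sub (continuous_integrable_complex p₁.continuous)
        (continuous_integrable_complex p₂.continuous), i₁, i₂, sub_self]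
    · apply Complex.ext
      · rw [cconv_sub, Complex.sub_re, Complex.ofReal_re]
        have := hJ t
        rw [r₁, r₂] at this
        linarith
      · rw [Complex.ofReal_im]
        refine cconv_im_eq_zero (fun x => ?_) t
        rw [ContinuousMap.sub_apply, Complex.sub_im, im_eq_zero_of_isBestApprox hμ h₁,
          im_eq_zero_of_isBestApprox hμ h₂, sub_zero]
  exact sub_eq_zero.1 hd

end TorusApprox

end

theorem mainTheorem8 :
    (∀ ν μ : SignedMeasure TorusApprox.Torus, ν Set.univ = 1 → μ Set.univ = 1 →
      MemLp (TorusApprox.bernoulliConv ν - TorusApprox.bernoulliConv μ) 1 volume ∧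
      IsLeast
        (Set.range fun c : ℝ => eLpNorm
          (fun t => TorusApprox.bernoulliConv ν t - TorusApprox.bernoulliConv μ t - c) 1 volume)
        (TorusApprox.W1 (TorusApprox.ofReal ν) (TorusApprox.ofReal μ)) ∧
      (TorusApprox.W1 (TorusApprox.ofReal ν) (TorusApprox.ofReal μ) =
          eLpNorm (TorusApprox.bernoulliConv ν - TorusApprox.bernoulliConv μ) 1 volume ↔
        volume {t | 0 < TorusApprox.bernoulliConv ν t - TorusApprox.bernoulliConv μ t} ≤ 1 / 2 ∧
        volume {t | TorusApprox.bernoulliConv ν t - TorusApprox.bernoulliConv μ t < 0} ≤ 1 / 2)) ∧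
    (∀ (n : ℕ) (μ : SignedMeasure TorusApprox.Torus), μ Set.univ = 1 →
      VectorMeasure.AbsolutelyContinuous μ
        (volume : Measure TorusApprox.Torus).toENNRealVectorMeasure →
      (∃! p : C(TorusApprox.Torus, ℂ), TorusApprox.IsBestApprox n (TorusApprox.ofReal μ) p) ∧
      ∀ p : C(TorusApprox.Torus, ℂ), TorusApprox.IsBestApprox n (TorusApprox.ofReal μ) p →
        ∀ x, (p x).im = 0) := by
  refine ⟨fun ν μ hν hμ => TorusApprox.wasserstein_eq_min_integral hν hμ, fun n μ hμ hac => ⟨?_, ?_⟩⟩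
  · obtain ⟨p, hp⟩ := TorusApprox.exists_isBestApprox n hμ
    exact ⟨p, hp, fun q hq => TorusApprox.isBestApprox_unique hμ hac hq hp⟩
  · exact fun p hp => TorusApprox.im_eq_zero_of_isBestApprox hμ hp
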